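/- Let $\mathcal A$ be a finite alphabet and $\eta\colon\mathbb Z^2\to\mathcal A$. For $\vec u\in\mathbb Z^2$ put $(T^{\vec u}\eta)(\vec x)=\eta(\vec x+\vec u)$, and let $X_\eta$ be the closure of $\{T^{\vec u}\eta:\vec u\in\mathbb Z^2\}$ in the product topology of $\mathcal A^{\mathbb Z^2}$ ($\mathcal A$ discrete). For a finite $S\subset\mathbb Z^2$ let $P_\eta(S)$ be the number of distinct restrictions $(T^{\vec u}\eta)|_S$, $\vec u\in\mathbb Z^2$, and $D_\eta(S)=P_\eta(S)-|S|$; let $R_{n,3}=\{0,\dots,n-1\}\times\{0,1,2\}$. If $S_1\subseteq S_2\subseteq\mathbb Z^2$ and $\alpha\in X_\eta$, then $\alpha|_{S_1}$ *extends uniquely to an $\eta$-coloring of $S_2$* if every $\beta\in X_\eta$ with $\beta|_{S_1}=\alpha|_{S_1}$ satisfies $\beta|_{S_2}=\alpha|_{S_2}$. A point $x\in S$ is *$\eta$-generated* by $S$ if for every $\vec u\in\mathbb Z^2$ the coloring $(T^{\vec u}\eta)|_{S\setminus\{x\}}$ extends uniquely to an $\eta$-coloring of $S$. Half-planes are closed,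 and their boundaries and the boundaries of convex polygons are positively oriented (the region lies to the left of its boundary). A directed line $\ell$ (only its direction matters) is a *nonexpansive direction for $\eta$* if there are $f\ne g$ in $X_\eta$ that agree on the integer points of the half-plane whose oriented boundary passes through the origin and is parallel to $\ell$ with the same direction. A finite set $S\subset\mathbb Z^2$ with $S=\operatorname{conv}(S)\cap\mathbb Z^2$ is *$\ell$-balanced* if $\operatorname{conv}(S)$ has positive area and (1) the positively oriented polygon $\operatorname{conv}(S)$ has an edge $w$ parallel to $\ell$ with the same direction; (2) both endpoints of $w$ are $\eta$-generated by $S$; (3) $D_\eta(S\setminus w)>D_\eta(S)$; (4) every line parallel to $\ell$ that meets $S$ contains at least $|w\cap S|-1$ points of $S$. For a finite nonempty $F\subset\mathbb Z^2$ let $B_\ell(F)$ be the set of integer points of the thinnest closed strip with edges parallel to $\ell$ that contains $F$. **Proposition.** Suppose there is $n\in\mathbb N$ with $P_\eta(R_{n,3})\le 3n$, let $\ell$ be a nonexpansive direction for $\eta$, and let $H$ be a half-plane whose oriented boundary is parallel to $\ell$ with the same direction. Let $f,g\in X_\eta$ with $f\neq g$ and $f|_{H\cap\mathbb Z^2}=g|_{H\cap\mathbb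 Z^2}$. Then $f$ and $g$ are both periodic with a nonzero period vector in $\mathbb Z^2$ parallel to $\ell$. Furthermore, let $S$ be an $\ell$-balanced set such that every line parallel to $\ell$ that contains a point of $B_\ell(S)$ contains a point of $S$, and let $w$ be the edge of $S$ parallel to $\ell$. Then for every $\vec u\in\mathbb Z^2$: 1. if $(T^{\vec u}f)|_{B_\ell(S\setminus w)}$ does not extend uniquely to an $\eta$-coloring of $B_\ell(S)$, then the period of $(T^{\vec u}f)|_{B_\ell(S\setminus w)}$ is at most $|w\cap\mathbb Z^2|-1$; 2. if $(T^{\vec u}f)|_{B_\ell(S\setminus w)}$ extends uniquely to an $\eta$-coloring of $B_\ell(S)$, then the period of $(T^{\vec u}f)|_{B_\ell(S\setminus w)}$ is at most $2|w\cap\mathbb Z^2|-2$. Here the period of a coloring $h$ of such a strip $B$ is the least integer $k\ge1$ with $h(\vec z+k\vec v)=h(\vec z)$ for all $\vec z\in B$, where $\vec v$ is the shortest nonzero integer vector pointing in the direction of $\ell$. -/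

import Mathlib

namespace Nivat

/-- The inclusion of `ℤ²` in the plane. -/
def toPlane (z : ℤ × ℤ) : ℝ × ℝ := ((z.1 : ℝ), (z.2 : ℝ))

/-- The translation action `(T^u η)(x) = η(x + u)`. -/
def shift {A : Type*} (u : ℤ × ℤ) (η : ℤ × ℤ → A) : ℤ × ℤ → A := fun x => η (x + u)

/-- The orbit closure `X_η` in the product topology (the alphabet is given the discrete topology). -/
def orbitClosure {A : Type*} [TopologicalSpace A] (η : ℤ × ℤ → A) : Set (ℤ × ℤ → A) :=
  closure (Set.range fun u : ℤ × ℤ => shift u η)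

/-- The set of `S`-words of `η`: restrictions to `S` of translates of `η`. -/
def words {A : Type*} (η : ℤ × ℤ → A) (S : Set (ℤ × ℤ)) : Set (S → A) :=
  Set.range fun u : ℤ × ℤ => S.domRestrict (shift u η)

/-- The complexity `P_η(S)`. -/
noncomputable def complexity {A : Type*} (η : ℤ × ℤ → A) (S : Set (ℤ × ℤ)) : ℕ :=
  (words η S).ncard

/-- The discrepancy `D_η(S) = P_η(S) - |S|`. -/
noncomputable def discrepancy {A : Type*} (η : ℤ × ℤ → A) (S : Set (ℤ × ℤ)) : ℤ :=
  (complexity η S : ℤ) - (S.ncard : ℤ)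

/-- The rectangle `R_{n,k}` of width `n` and height `k`. -/
def rect (n k : ℕ) : Set (ℤ × ℤ) := {z | 0 ≤ z.1 ∧ z.1 < n ∧ 0 ≤ z.2 ∧ z.2 < k}

/-- For `α ∈ X_η` and `S₁ ⊆ S₂`: the coloring `α|S₁` extends uniquely to an `η`-coloring of `S₂`. -/
def ExtendsUniquely {A : Type*} [TopologicalSpace A] (η α : ℤ × ℤ → A) (S₁ S₂ : Set (ℤ × ℤ)) :
    Prop :=
  ∀ β ∈ orbitClosure η, Set.EqOn α β S₁ → Set.EqOn α β S₂

/-- The point `x` is `η`-generated by `S`: every `η`-coloring of `S \ {x}` extends uniquely to an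
`η`-coloring of `S`. -/
def IsGenerated {A : Type*} [TopologicalSpace A] (η : ℤ × ℤ → A) (S : Set (ℤ × ℤ)) (x : ℤ × ℤ) :
    Prop :=
  x ∈ S ∧ ∀ u : ℤ × ℤ, ExtendsUniquely η (shift u η) (S \ {x}) S

/-- The signed area spanned by `d` and `x`; it is positive exactly when `x` lies strictly to the
left of the line through the origin directed by `d`, and its level sets are the lines parallel
to `d`. -/
def cross (d x : ℝ × ℝ) : ℝ := d.1 * x.2 - d.2 * x.1

/-- The closed half-planes whose positively oriented boundary is parallel to the direction `d`,
i.e. which lie to the left of their boundary directed by `d`; the boundary passes through the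
origin for `c = 0`. -/
def halfPlane (d : ℝ × ℝ) (c : ℝ) : Set (ℝ × ℝ) := {x | c ≤ cross d x}

/-- Two configurations agree on (the integer points of) a region of the plane. -/
def AgreeOn {A : Type*} (f g : ℤ × ℤ → A) (H : Set (ℝ × ℝ)) : Prop :=
  ∀ z : ℤ × ℤ, toPlane z ∈ H → f z = g z

/-- The direction `d` is a nonexpansive direction for `η`. -/
def IsNonexpansiveDirection {A : Type*} [TopologicalSpace A] (η : ℤ × ℤ → A) (d : ℝ × ℝ) :
    Prop :=
  ∃ f ∈ orbitClosure η, ∃ g ∈ orbitClosure η, f ≠ g ∧ AgreeOn f g (halfPlane d 0)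

/-- The convex hull in the plane of a set of integer points. -/
def hull (S : Set (ℤ × ℤ)) : Set (ℝ × ℝ) := convexHull ℝ (toPlane '' S)

/-- `S` is convex: it consists of all the integer points of its convex hull. -/
def IsLatticeConvex (S : Set (ℤ × ℤ)) : Prop := S = {z | toPlane z ∈ hull S}

/-- The segment from `a` to `b` is an edge of the polygon `conv(S)`, directed from `a` to `b` by the
positive (counterclockwise) orientation of the boundary: `conv(S)` has positive area, lies to the
left of the directed segment, and meets the line through `a` and `b` exactly in the segment. -/
structure IsEdge (S : Set (ℤ × ℤ)) (a b : ℤ × ℤ) : Prop where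
  area_pos : 0 < MeasureTheory.volume (hull S)
  ne : a ≠ b
  left : ∀ x ∈ hull S, 0 ≤ cross (toPlane (b - a)) (x - toPlane a)
  face : {x ∈ hull S | cross (toPlane (b - a)) (x - toPlane a) = 0} =
    segment ℝ (toPlane a) (toPlane b)

/-- The integer points of the segment from `a` to `b`. -/
def edgePoints (a b : ℤ × ℤ) : Set (ℤ × ℤ) := {z | toPlane z ∈ segment ℝ (toPlane a) (toPlane b)}

/-- The integer vector `v` points in the direction `d`. -/
def PointsAlong (d : ℝ × ℝ) (v : ℤ × ℤ) : Prop := ∃ c : ℝ, 0 < c ∧ toPlane v = c • d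

/-- The finite convex set `S` is balanced for the direction `d` (and for `η`). -/
def IsBalanced {A : Type*} [TopologicalSpace A] (η : ℤ × ℤ → A) (d : ℝ × ℝ) (S : Set (ℤ × ℤ)) :
    Prop :=
  S.Finite ∧ IsLatticeConvex S ∧
    ∃ a b : ℤ × ℤ,
      (IsEdge S a b ∧ PointsAlong d (b - a)) ∧
      (IsGenerated η S a ∧ IsGenerated η S b) ∧
      discrepancy η S < discrepancy η (S \ edgePoints a b) ∧
      ∀ c : ℝ, (S ∩ {z | cross d (toPlane z) = c}).Nonempty →
        (edgePoints a b ∩ S).ncard ≤ (S ∩ {z | cross d (toPlane z) = c}).ncard + 1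

/-- The integer points of the border of `S`, the thinnest closed strip with edges parallel to `d`
that contains `S` (for `S` finite and nonempty). -/
def border (d : ℝ × ℝ) (S : Set (ℤ × ℤ)) : Set (ℤ × ℤ) :=
  {z | ∃ s ∈ S, ∃ t ∈ S,
    cross d (toPlane s) ≤ cross d (toPlane z) ∧ cross d (toPlane z) ≤ cross d (toPlane t)}

/-- Every line parallel to `d` that contains an integer point of the border of `S` contains a point
of `S`. -/
def MeetsEveryLine (d : ℝ × ℝ) (S : Set (ℤ × ℤ)) : Prop :=
  ∀ z ∈ border d S, ∃ s ∈ S, cross d (toPlane s) = cross d (toPlane z)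

/-- `f` is periodic with a (nonzero, integer) period vector parallel to `d`. -/
def IsPeriodicAlong {A : Type*} (d : ℝ × ℝ) (f : ℤ × ℤ → A) : Prop :=
  ∃ v : ℤ × ℤ, v ≠ 0 ∧ cross d (toPlane v) = 0 ∧ ∀ z, f (z + v) = f z

/-- The restriction of `f` to the strip `B` with edges parallel to `d` is periodic along `d` with
period at most `N`, the period being counted in multiples of the shortest integer vector in the
direction `d`. -/
def HasPeriodAtMost {A : Type*} (d : ℝ × ℝ) (B : Set (ℤ × ℤ)) (f : ℤ × ℤ → A) (N : ℕ) : Prop :=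
  ∃ v : ℤ × ℤ, PointsAlong d v ∧ Int.gcd v.1 v.2 = 1 ∧
    ∃ k : ℕ, 1 ≤ k ∧ k ≤ N ∧ ∀ z ∈ B, f (z + k • v) = f z

end Nivat

namespace Nivat

/-- A sequence is deterministic if each term determines the next one. -/
def Deterministic {B : Type*} (x : ℤ → B) : Prop := ∀ j k, x j = x k → x (j + 1) = x (k + 1)

theorem Deterministic.add_nat {B : Type*} {x : ℤ → B} (hx : Deterministic x) {j k : ℤ}
    (h : x j = x k) (n : ℕ) : x (j + n) = x (k + n) := by
  induction n with
  | zero => simpa using h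
  | succ n ih => push_cast; rw [← add_assoc, ← add_assoc]; exact hx _ _ ih

theorem periodic_mul {B : Type*} {x : ℤ → B} {p : ℤ} (hp : ∀ k, x (k + p) = x k) (n k : ℤ) :
    x (k + n * p) = x k := by
  induction n using Int.induction_on with
  | zero => simp
  | succ n ih => rw [add_mul, one_mul, ← add_assoc, hp, ih]
  | pred n ih => rw [← hp, ← ih]; congr 1; ring

/-- A bi-infinite deterministic sequence with finitely many values is periodic. -/
theorem Deterministic.exists_period {B : Type*} {x : ℤ → B} (hx : Deterministic x)
    (hfin : (Set.range x).Finite) {N : ℕ} (hN : (Set.range x).ncard ≤ N) :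
    ∃ p : ℕ, 1 ≤ p ∧ p ≤ N ∧ ∀ k, x (k + p) = x k := by
  by_contra! hcon
  have hcon' : ∀ p : ℕ, ∃ k : ℤ, 1 ≤ p → p ≤ N → x (k + p) ≠ x k := by
    intro p
    by_cases h1 : 1 ≤ p
    · by_cases h2 : p ≤ N
      · obtain ⟨k, hk⟩ := hcon p h1 h2
        exact ⟨k, fun _ _ => hk⟩
      · exact ⟨0, fun _ h => absurd h h2⟩
    · exact ⟨0, fun h => absurd h h1⟩
  choose κ hκ using hcon'
  obtain ⟨K, hK⟩ : ∃ K : ℤ, ∀ p ∈ Finset.range (N + 1), K ≤ κ p := by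
    obtain ⟨K, hK⟩ := ((Finset.range (N + 1)).image κ).bddBelow
    exact ⟨K, fun p hp => hK (by simpa using ⟨p, by simpa using hp, rfl⟩)⟩
  obtain ⟨i, hi, j, hj, hij, hxij⟩ : ∃ i ∈ Finset.range (N + 1), ∃ j ∈ Finset.range (N + 1),
      i ≠ j ∧ x (K - N + i) = x (K - N + j) := by
    refine Finset.exists_ne_map_eq_of_card_lt_of_maps_to (t := hfin.toFinset)
      (f := fun i : ℕ => x (K - N + i)) ?_ ?_
    · rw [← Set.ncard_eq_toFinset_card _ hfin, Finset.card_range]; omega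
    · intro i _; simp
  wlog hlt : i < j generalizing i j
  · exact this j hj i hi hij.symm hxij.symm (by omega)
  simp only [Finset.mem_range] at hi hj
  have hp := hκ (j - i) (by omega) (by omega)
  have hKp := hK (j - i) (by simp; omega)
  apply hp
  obtain ⟨n, hn⟩ := Int.eq_ofNat_of_zero_le (a := κ (j - i) - (K - N + i)) (by omega)
  have := hx.add_nat hxij n
  rw [← hn] at this
  rw [show κ (j - i) = K - N + i + (κ (j - i) - (K - N + i)) by ring, this]
  congr 1
  push_cast [hlt.le]
  ring

theorem Deterministic.add_int {B : Type*} {x : ℤ → B} (hx : Deterministic x)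
    {p : ℕ} (hp1 : 1 ≤ p) (hp : ∀ k, x (k + p) = x k) {j k : ℤ}
    (h : x j = x k) (n : ℤ) : x (j + n) = x (k + n) := by
  have h1 := periodic_mul (p := (p : ℤ)) hp |n|
  rw [← h1 (j + n), ← h1 (k + n)]
  have : 0 ≤ n + |n| * p := by
    have : |n| ≤ |n| * p := le_mul_of_one_le_right (abs_nonneg n) (by exact_mod_cast hp1)
    have := neg_abs_le n
    omega
  obtain ⟨N, hN⟩ := Int.eq_ofNat_of_zero_le this
  rw [add_assoc, add_assoc, hN]
  exact hx.add_nat h N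

/-- The block of length `m` of the sequence `x` at position `k`. -/
def block {B : Type*} (x : ℤ → B) (m : ℕ) (k : ℤ) : Fin m → B := fun j => x (k + (j : ℕ))

/-- **Morse-Hedlund**: a sequence with at most `m` blocks of length `m` has deterministic blocks. -/
theorem deterministic_block {B : Type*} [Finite B] {x : ℤ → B} {m : ℕ}
    (h : (Set.range (block x m)).ncard ≤ m) : Deterministic (block x m) := by
  obtain ⟨i, him, hi⟩ : ∃ i < m, ∀ j k, block x i j = block x i k → x (j + i) = x (k + i) := by
    by_contra! hcon
    have key : ∀ i ≤ m, i + 1 ≤ (Set.range (block x i)).ncard := by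
      intro i
      induction i with
      | zero =>
        intro _
        exact (Set.ncard_pos (Set.toFinite _)).2 (Set.range_nonempty _)
      | succ i ih =>
        intro hi
        obtain ⟨j, k, hjk, hne⟩ := hcon i (by omega)
        have him : Set.range (block x i) =
            (fun b : Fin (i + 1) → B => fun l : Fin i => b l.castSucc) ''
              Set.range (block x (i + 1)) := by
          rw [← Set.range_comp]; rfl
        have hlt : (Set.range (block x i)).ncard < (Set.range (block x (i + 1))).ncard := by
          rw [him]
          refine lt_of_le_of_ne (Set.ncard_image_le (Set.toFinite _)) fun heq => ?_
          have hinj := (Set.ncard_image_iff (Set.toFinite _)).1 heq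
          have := hinj ⟨j, rfl⟩ ⟨k, rfl⟩ hjk
          have := congrFun this (Fin.last i)
          exact hne (by simpa [block] using this)
        have := ih (by omega)
        omega
    have := key m le_rfl
    omega
  intro j k hjk
  have hval : ∀ l : ℕ, l < m → x (j + l) = x (k + l) := fun l hl => congrFun hjk ⟨l, hl⟩
  funext ⟨l, hl⟩
  simp only [block]
  by_cases hlm : l + 1 < m
  · have := hval (l + 1) hlm
    push_cast at this
    rw [add_assoc, add_assoc, add_comm 1 (l : ℤ), this]
  · have hi' := hi (j + ((m - i : ℕ) : ℤ)) (k + ((m - i : ℕ) : ℤ)) (by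
      funext ⟨t, ht⟩
      simp only [block]
      have := hval (m - i + t) (by omega)
      push_cast at this ⊢
      rw [add_assoc, add_assoc, this])
    have e1 : ((m - i : ℕ) : ℤ) + i = 1 + l := by omega
    rw [add_assoc, add_assoc, e1] at hi'
    rw [add_assoc, add_assoc, hi']

/-- Sequences with values in a finite set that satisfy a fixed linear recurrence have a common
period. -/
theorem exists_common_period {K : Type*} [Field K] (q : ℤ →₀ K) (hq : q ≠ 0) {D : Set K}
    (hD : D.Finite) :
    ∃ M : ℕ, 1 ≤ M ∧ ∀ ζ : ℤ → K, (∀ k, ζ k ∈ D) → (∀ k, q.sum (fun j a => a * ζ (k + j)) = 0) →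
      ∀ k, ζ (k + M) = ζ k := by
  classical
  have hne : q.support.Nonempty := Finsupp.support_nonempty_iff.2 hq
  set t := q.support.max' hne with ht
  set b := q.support.min' hne with hb
  obtain ⟨d, hd⟩ := Int.eq_ofNat_of_zero_le (a := t - b)
    (sub_nonneg.2 (Finset.min'_le _ _ (Finset.max'_mem _ _)))
  set F := Fintype.piFinset fun _ : Fin d => hD.toFinset
  refine ⟨F.card.factorial, Nat.factorial_pos _, fun ζ hζ hrec => ?_⟩
  have hdet : Deterministic (block ζ d) := by
    intro j k hjk
    have hval : ∀ l : ℕ, l < d → ζ (j + l) = ζ (k + l) := fun l hl => congrFun hjk ⟨l, hl⟩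
    have hlast : ζ (j + d) = ζ (k + d) := by
      have h1 := hrec (j - b)
      have h2 := hrec (k - b)
      rw [Finsupp.sum, ← Finset.add_sum_erase _ _ (Finset.max'_mem _ hne)] at h1 h2
      have h3 : ∑ i ∈ q.support.erase t, q i * ζ (j - b + i)
          = ∑ i ∈ q.support.erase t, q i * ζ (k - b + i) := by
        refine Finset.sum_congr rfl fun i hi => ?_
        have hi2 := Finset.mem_of_mem_erase hi
        have hi1 : i < t := lt_of_le_of_ne (Finset.le_max' _ _ hi2) (Finset.ne_of_mem_erase hi)
        have hi3 : b ≤ i := Finset.min'_le _ _ hi2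
        obtain ⟨l, hl⟩ := Int.eq_ofNat_of_zero_le (sub_nonneg.2 hi3)
        have := hval l (by omega)
        rw [show j - b + i = j + l by omega, show k - b + i = k + l by omega, this]
      rw [h3] at h1
      have h4 := h1.trans h2.symm
      have h5 := mul_left_cancel₀ (Finsupp.mem_support_iff.1 (Finset.max'_mem _ hne))
        (add_right_cancel h4)
      rwa [← ht, show j - b + t = j + d by omega, show k - b + t = k + d by omega] at h5
    funext ⟨l, hl⟩
    simp only [block]
    rw [add_assoc, add_assoc, add_comm 1 (l : ℤ)]
    rcases Nat.lt_or_ge (l + 1) d with h | h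
    · exact_mod_cast hval (l + 1) h
    · rw [show (l : ℤ) + 1 = d by omega]; exact hlast
  have hsub : Set.range (block ζ d) ⊆ F := by
    rintro _ ⟨k, rfl⟩
    simp [F, block, hζ]
  obtain ⟨p, hp1, hp2, hp⟩ := hdet.exists_period (F.finite_toSet.subset hsub)
    (N := F.card) (by
      rw [← Set.ncard_coe_finset]
      exact Set.ncard_le_ncard hsub F.finite_toSet)
  obtain ⟨c, hc⟩ := Nat.dvd_factorial hp1 hp2
  have hb' := periodic_mul (x := block ζ d) (p := (p : ℤ)) hp c
  rcases Nat.eq_zero_or_pos d with h0 | hpos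
  · have hz : ∀ k, ζ k = 0 := by
      intro k
      have h1 := hrec (k - b)
      have hone : q.support = {b} := by
        refine Finset.eq_singleton_iff_unique_mem.2 ⟨Finset.min'_mem _ _, fun i hi => ?_⟩
        have := Finset.le_max' _ _ hi
        have := Finset.min'_le _ _ hi
        omega
      rw [Finsupp.sum, hone, Finset.sum_singleton, sub_add_cancel] at h1
      exact (mul_eq_zero.1 h1).resolve_left (Finsupp.mem_support_iff.1 (Finset.min'_mem _ hne))
    intro k; rw [hz, hz]
  · intro k
    have := congrFun (hb' k) ⟨0, hpos⟩
    simp only [block, Nat.cast_zero, add_zero] at this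
    rw [hc, ← this]; push_cast; ring_nf

section Words

variable {A : Type*}

/-- The words of `f` at the positions `t ∈ T`. -/
def wordsAt (f : ℤ × ℤ → A) (S T : Set (ℤ × ℤ)) : Set (S → A) :=
  (fun t => S.domRestrict (shift t f)) '' T

theorem image_wordsAt (f : ℤ × ℤ → A) {S' S : Set (ℤ × ℤ)} (h : S' ⊆ S) (T : Set (ℤ × ℤ)) :
    (fun (φ : S → A) (s : S') => φ ⟨s, h s.2⟩) '' wordsAt f S T = wordsAt f S' T := by
  rw [wordsAt, wordsAt, ← Set.image_comp]; rfl

theorem words_eq_wordsAt (η : ℤ × ℤ → A) (S : Set (ℤ × ℤ)) :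
    words η S = wordsAt η S Set.univ := by
  rw [wordsAt, Set.image_univ]; rfl

theorem complexity_empty (η : ℤ × ℤ → A) : complexity η ∅ = 1 := by
  rw [complexity, Set.ncard_eq_one]
  exact ⟨fun s => absurd s.2 (Set.notMem_empty _), Set.eq_singleton_iff_unique_mem.2
    ⟨⟨0, funext fun s => absurd s.2 (Set.notMem_empty _)⟩, fun φ _ => funext fun s => absurd s.2 (Set.notMem_empty _)⟩⟩

end Words

section Orbit

variable {A : Type*} [TopologicalSpace A] {η f g : ℤ × ℤ → A}

theorem shift_mem_orbitClosure (hf : f ∈ orbitClosure η) (u : ℤ × ℤ) :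
    shift u f ∈ orbitClosure η := by
  have hc : Continuous (shift u : (ℤ × ℤ → A) → ℤ × ℤ → A) :=
    continuous_pi fun x => continuous_apply (x + u)
  refine map_mem_closure hc hf ?_
  rintro _ ⟨w, rfl⟩
  refine ⟨u + w, ?_⟩
  funext x
  simp [shift, add_assoc]

/-- Every finite pattern of a point of the orbit closure occurs in the configuration. -/
theorem exists_shift_eqOn [DiscreteTopology A] (hf : f ∈ orbitClosure η) {S : Set (ℤ × ℤ)}
    (hS : S.Finite) : ∃ u, Set.EqOn f (shift u η) S := by
  have hopen : IsOpen (S.pi fun s => {f s}) := isOpen_set_pi hS fun s _ => isOpen_discrete _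
  obtain ⟨h, hh, u, rfl⟩ := mem_closure_iff.1 hf _ hopen fun s _ => rfl
  exact ⟨u, fun s hs => (hh s hs).symm⟩

theorem domRestrict_shift_mem_words [DiscreteTopology A] (hf : f ∈ orbitClosure η)
    {S : Set (ℤ × ℤ)} (hS : S.Finite) (u : ℤ × ℤ) :
    S.domRestrict (shift u f) ∈ words η S := by
  obtain ⟨w, hw⟩ := exists_shift_eqOn (shift_mem_orbitClosure hf u) hS
  exact ⟨w, funext fun s => (hw s.2).symm⟩

theorem IsGenerated.eq_of_eqOn [DiscreteTopology A] {S : Set (ℤ × ℤ)} {x : ℤ × ℤ}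
    (hx : IsGenerated η S x) (hS : S.Finite) (hf : f ∈ orbitClosure η) (hg : g ∈ orbitClosure η)
    (h : Set.EqOn f g (S \ {x})) : f x = g x := by
  obtain ⟨u, hu⟩ := exists_shift_eqOn hf hS
  have := hx.2 u g hg fun s hs => (hu hs.1).symm.trans (h hs)
  exact (hu hx.1).trans (this hx.1)

theorem wordsAt_subset [DiscreteTopology A] (hf : f ∈ orbitClosure η)
    {S : Set (ℤ × ℤ)} (hS : S.Finite) (T : Set (ℤ × ℤ)) : wordsAt f S T ⊆ words η S := by
  rintro _ ⟨t, _, rfl⟩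
  exact domRestrict_shift_mem_words hf hS t

/-- If `f` and `g` agree on the translates of `S'` but not on those of `S ⊇ S'`, then the words of
`f` on these translates of `S'` are counted by the increase of the complexity from `S'` to `S`. -/
theorem ncard_wordsAt_add_complexity_le [Finite A] [DiscreteTopology A]
    (hf : f ∈ orbitClosure η) (hg : g ∈ orbitClosure η)
    {S' S T : Set (ℤ × ℤ)} (hS : S.Finite) (hS' : S' ⊆ S)
    (hag : ∀ t ∈ T, ∀ s ∈ S', f (s + t) = g (s + t))
    (hne : ∀ t ∈ T, ∃ s ∈ S, f (s + t) ≠ g (s + t)) :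
    (wordsAt f S' T).ncard + complexity η S' ≤ complexity η S := by
  have : Nonempty A := ⟨η 0⟩
  have := hS.to_subtype
  have := (hS.subset hS').to_subtype
  set r : (S → A) → (S' → A) := fun φ s => φ ⟨s, hS' s.2⟩ with hr
  have himg : r '' words η S = words η S' := by
    rw [words_eq_wordsAt, words_eq_wordsAt]; exact image_wordsAt η hS' _
  have hsec : ∀ φ ∈ words η S', ∃ ψ ∈ words η S, r ψ = φ := by
    intro φ hφ; rwa [← himg] at hφ
  choose! σ hσ1 hσ2 using hsec
  have hbad : ∀ φ ∈ wordsAt f S' T, ∃ ψ ∈ words η S, r ψ = φ ∧ ψ ≠ σ φ := by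
    rintro _ ⟨t, ht, rfl⟩
    by_cases h : S.domRestrict (shift t f) = σ (S'.domRestrict (shift t f))
    · refine ⟨S.domRestrict (shift t g), domRestrict_shift_mem_words hg hS t, ?_, ?_⟩
      · funext s; exact (hag t ht s s.2).symm
      · rw [← h]
        intro heq
        obtain ⟨s, hs, hsne⟩ := hne t ht
        exact hsne (congrFun heq ⟨s, hs⟩).symm
    · exact ⟨_, domRestrict_shift_mem_words hf hS t, rfl, h⟩
  choose! τ hτ1 hτ2 hτ3 using hbad
  have hsub := wordsAt_subset hf (hS.subset hS') T
  have hinjσ : Set.InjOn σ (words η S') := fun φ hφ ψ hψ h => by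
    rw [← hσ2 φ hφ, ← hσ2 ψ hψ, h]
  have hinjτ : Set.InjOn τ (wordsAt f S' T) := fun φ hφ ψ hψ h => by
    rw [← hτ2 φ hφ, ← hτ2 ψ hψ, h]
  have hdisj : Disjoint (τ '' wordsAt f S' T) (σ '' words η S') := by
    rw [Set.disjoint_left]
    rintro _ ⟨φ, hφ, rfl⟩ ⟨ψ, hψ, h⟩
    have : ψ = φ := by rw [← hσ2 ψ hψ, h, hτ2 φ hφ]
    subst this
    exact hτ3 ψ hφ h.symm
  rw [complexity, complexity, ← hinjσ.ncard_image, ← hinjτ.ncard_image,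
    ← Set.ncard_union_eq hdisj (Set.toFinite _) (Set.toFinite _)]
  refine Set.ncard_le_ncard (Set.union_subset ?_ ?_) (Set.toFinite _)
  · rintro _ ⟨φ, hφ, rfl⟩; exact hτ1 φ hφ
  · rintro _ ⟨φ, hφ, rfl⟩; exact hσ1 φ hφ

/-- The number of words of `f` on some translates of `S` exceeds the number of words on the
corresponding translates of `S' ⊆ S` at most by the increase of the complexity. -/
theorem ncard_wordsAt_le [Finite A] [DiscreteTopology A] (hf : f ∈ orbitClosure η)
    {S' S : Set (ℤ × ℤ)} (hS : S.Finite) (hS' : S' ⊆ S) (T : Set (ℤ × ℤ)) :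
    (wordsAt f S T).ncard + complexity η S' ≤ (wordsAt f S' T).ncard + complexity η S := by
  have := hS.to_subtype
  have := (hS.subset hS').to_subtype
  set r : (S → A) → (S' → A) := fun φ s => φ ⟨s, hS' s.2⟩ with hr
  have himg : r '' words η S = words η S' := by
    rw [words_eq_wordsAt, words_eq_wordsAt]; exact image_wordsAt η hS' _
  have himg' : r '' wordsAt f S T = wordsAt f S' T := image_wordsAt f hS' T
  have h1 : words η S' = wordsAt f S' T ∪ r '' (words η S \ wordsAt f S T) := by
    rw [← himg', ← Set.image_union, Set.union_sdiff_cancel (wordsAt_subset hf hS T), himg]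
  have h2 := Set.ncard_union_le (wordsAt f S' T) (r '' (words η S \ wordsAt f S T))
  rw [← h1] at h2
  have h3 := Set.ncard_image_le (f := r) (Set.toFinite (words η S \ wordsAt f S T))
  have h4 := Set.ncard_sdiff_add_ncard_of_subset (wordsAt_subset hf hS T) (Set.toFinite _)
  simp only [complexity]
  omega

end Orbit

section Lines

/-- The positions `k • v`, `k ∈ ℤ`. -/
def line (v : ℤ × ℤ) : Set (ℤ × ℤ) := Set.range fun k : ℤ => k • v

/-- If `f` has at most `m` words on the translates of `S` along `v` and `S` contains `m`
consecutive points of some lines parallel to `v`, then `f` has period at most `m` along these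
lines, and the words on `S` determine `f` there. -/
theorem exists_period_on_lines {A ι : Type*} [Finite A] [Finite ι] (f : ℤ × ℤ → A) (v : ℤ × ℤ)
    {S : Set (ℤ × ℤ)} (hS : S.Finite) {m : ℕ} (hm : 1 ≤ m)
    (hcard : (wordsAt f S (line v)).ncard ≤ m)
    (q : ι → ℤ × ℤ) (hq : ∀ i, ∀ j : ℕ, j < m → q i + (j : ℤ) • v ∈ S) :
    (∃ p : ℕ, 1 ≤ p ∧ p ≤ m ∧ ∀ i, ∀ k : ℤ, f (q i + (k + p) • v) = f (q i + k • v)) ∧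
    ∀ k k' : ℤ, S.domRestrict (shift (k • v) f) = S.domRestrict (shift (k' • v) f) →
      ∀ i, ∀ n : ℤ, f (q i + (k + n) • v) = f (q i + (k' + n) • v) := by
  have := hS.to_subtype
  set x : ℤ → ι → A := fun k i => f (q i + k • v) with hx
  have hblock : Set.range (block x m) =
      (fun (φ : S → A) (j : Fin m) (i : ι) => φ ⟨_, hq i j j.2⟩) '' wordsAt f S (line v) := by
    rw [wordsAt, line, ← Set.range_comp, ← Set.range_comp]
    congr 1
    funext k j i
    simp only [block, hx, Function.comp, shift, Set.domRestrict_apply]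
    congr 1
    module
  have hdet : Deterministic (block x m) := by
    apply deterministic_block
    rw [hblock]
    exact (Set.ncard_image_le (Set.toFinite _)).trans hcard
  obtain ⟨p, hp1, hpm, hp⟩ := hdet.exists_period (Set.toFinite _) (N := m) (by
    rw [hblock]
    exact (Set.ncard_image_le (Set.toFinite _)).trans hcard)
  refine ⟨⟨p, hp1, hpm, fun i k => ?_⟩, fun k k' hkk i n => ?_⟩
  · have := congrFun (congrFun (hp k) ⟨0, hm⟩) i
    simpa [block, hx] using this
  · have h1 : block x m k = block x m k' := by
      funext j i
      have := congrFun hkk ⟨_, hq i j j.2⟩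
      simp only [Set.domRestrict_apply, shift] at this
      simp only [block, hx]
      convert this using 2 <;> module
    have := congrFun (congrFun (hdet.add_int hp1 hp h1 n) ⟨0, hm⟩) i
    simpa [block, hx] using this

end Lines

/-- The level of `z` with respect to the direction `v`: the integral version of `cross`. -/
def lev (v z : ℤ × ℤ) : ℤ := v.1 * z.2 - v.2 * z.1

@[simp] theorem lev_add (v x y : ℤ × ℤ) : lev v (x + y) = lev v x + lev v y := by
  simp [lev]; ring

@[simp] theorem lev_sub (v x y : ℤ × ℤ) : lev v (x - y) = lev v x - lev v y := by
  simp [lev]; ring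

@[simp] theorem lev_smul (v : ℤ × ℤ) (k : ℤ) (x : ℤ × ℤ) : lev v (k • x) = k * lev v x := by
  simp [lev]; ring

@[simp] theorem lev_self (v : ℤ × ℤ) : lev v v = 0 := by simp [lev]; ring

@[simp] theorem lev_neg_left (v x : ℤ × ℤ) : lev (-v) x = -lev v x := by simp [lev]; ring

theorem exists_lev_eq_one {v : ℤ × ℤ} (hv : IsCoprime v.1 v.2) : ∃ e, lev v e = 1 := by
  obtain ⟨p, q, h⟩ := hv
  exact ⟨(-q, p), by simp [lev]; linarith⟩

theorem eq_smul_of_lev_eq_zero {v : ℤ × ℤ} (hv : IsCoprime v.1 v.2) {z : ℤ × ℤ}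
    (h : lev v z = 0) : ∃ k : ℤ, z = k • v := by
  obtain ⟨p, q, hpq⟩ := hv
  simp only [lev] at h
  refine ⟨p * z.1 + q * z.2, Prod.ext ?_ ?_⟩
  · simp only [Prod.smul_fst, smul_eq_mul]
    linear_combination (-z.1) * hpq - q * h
  · simp only [Prod.smul_snd, smul_eq_mul]
    linear_combination (-z.2) * hpq + p * h

theorem eq_add_smul_of_lev_eq {v : ℤ × ℤ} (hv : IsCoprime v.1 v.2) {x y : ℤ × ℤ}
    (h : lev v x = lev v y) : ∃ k : ℤ, x = y + k • v := by
  obtain ⟨k, hk⟩ := eq_smul_of_lev_eq_zero hv (z := x - y) (by simp [h])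
  exact ⟨k, by rw [← hk]; abel⟩

theorem ne_zero_of_isCoprime {v : ℤ × ℤ} (hv : IsCoprime v.1 v.2) : v ≠ 0 := by
  rintro rfl
  exact not_isUnit_zero (isCoprime_zero_left.1 hv)

theorem add_smul_injective {v : ℤ × ℤ} (hv : IsCoprime v.1 v.2) (s : ℤ × ℤ) :
    Function.Injective fun j : ℤ => s + j • v := fun i j h => by
  have h' : i • v = j • v := add_left_cancel h
  exact smul_left_injective ℤ (ne_zero_of_isCoprime hv) h'

/-- The finite linear combination `a` of translations maps `u` to the constant `c`. -/
def Annihilates (a : ℤ × ℤ →₀ ℂ) (c : ℂ) (u : ℤ × ℤ → ℂ) : Prop :=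
  ∀ x, a.sum (fun s α => α * u (s + x)) = c

theorem Annihilates.sub {a : ℤ × ℤ →₀ ℂ} {c c' : ℂ} {u u' : ℤ × ℤ → ℂ} (h : Annihilates a c u)
    (h' : Annihilates a c' u') : Annihilates a (c - c') fun z => u z - u' z := fun x => by
  rw [← h x, ← h' x, ← Finsupp.sum_sub]
  simp only [mul_sub]

theorem Annihilates.comp_add {a : ℤ × ℤ →₀ ℂ} {c : ℂ} {u : ℤ × ℤ → ℂ} (h : Annihilates a c u)
    (w : ℤ × ℤ) : Annihilates a c fun z => u (z + w) := fun x => by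
  rw [← h (x + w)]
  simp only [add_assoc]

theorem exists_injective_complex (A : Type*) [Finite A] : ∃ ι : A → ℂ, Function.Injective ι := by
  obtain ⟨k, ⟨φ⟩⟩ := Finite.exists_equiv_fin A
  exact ⟨fun a => ((φ a : ℕ) : ℂ), fun a b h => φ.injective (Fin.ext (Nat.cast_injective h))⟩

/-- Low complexity yields a linear annihilator. -/
theorem exists_annihilates {A : Type*} [Finite A] [TopologicalSpace A] [DiscreteTopology A]
    {η : ℤ × ℤ → A} (ι : A → ℂ) {S : Set (ℤ × ℤ)} (hS : S.Finite)
    (h : complexity η S ≤ S.ncard) :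
    ∃ a : ℤ × ℤ →₀ ℂ, a ≠ 0 ∧ (∀ s ∈ a.support, s ∈ S) ∧
      ∃ c, ∀ f ∈ orbitClosure η, Annihilates a c (ι ∘ f) := by
  classical
  have hfin := hS.to_subtype
  have := Fintype.ofFinite S
  have hWf : (words η S).Finite := Set.toFinite _
  have := hWf.fintype
  let Φ : ((S → ℂ) × ℂ) →ₗ[ℂ] (words η S → ℂ) :=
    { toFun := fun α φ => (∑ s, α.1 s * ι (φ.1 s)) - α.2
      map_add' := fun α β => by
        funext φ; simp [add_mul, Finset.sum_add_distrib]; ring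
      map_smul' := fun r α => by
        funext φ; simp [Finset.mul_sum, mul_sub, mul_assoc] }
  have hker : LinearMap.ker Φ ≠ ⊥ := by
    apply LinearMap.ker_ne_bot_of_finrank_lt
    rw [Module.finrank_prod, Module.finrank_fintype_fun_eq_card,
      Module.finrank_fintype_fun_eq_card, Module.finrank_self, ← Nat.card_eq_fintype_card,
      ← Nat.card_eq_fintype_card, Nat.card_coe_set_eq, Nat.card_coe_set_eq]
    exact Nat.lt_succ_of_le h
  obtain ⟨⟨α, c⟩, hα, hne⟩ := Submodule.exists_mem_ne_zero_of_ne_bot hker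
  have hrel : ∀ φ ∈ words η S, ∑ s, α s * ι (φ s) = c := by
    intro φ hφ
    have := congrFun (LinearMap.mem_ker.1 hα) ⟨φ, hφ⟩
    exact sub_eq_zero.1 this
  let a : ℤ × ℤ →₀ ℂ := Finsupp.onFinset hS.toFinset
    (fun z => if hz : z ∈ S then α ⟨z, hz⟩ else 0) (fun z hz => by
      rw [Set.Finite.mem_toFinset]; by_contra h; simp [h] at hz)
  have haS : ∀ s : S, a s = α s := fun s => by simp [a]
  refine ⟨a, ?_, fun s hs => ?_, c, fun f hf x => ?_⟩
  · intro ha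
    have hα0 : α = 0 := by
      funext s; rw [← haS, ha]; rfl
    obtain ⟨φ, hφ⟩ : (words η S).Nonempty := Set.range_nonempty _
    have := hrel φ hφ
    simp only [hα0, Pi.zero_apply, zero_mul, Finset.sum_const_zero] at this
    exact hne (Prod.ext hα0 this.symm)
  · by_contra hsS
    exact Finsupp.mem_support_iff.1 hs (by simp [a, hsS])
  · rw [← hrel _ (domRestrict_shift_mem_words hf hS x)]
    rw [Finsupp.onFinset_sum _ (fun s => by simp)]
    rw [Finset.sum_subtype hS.toFinset (p := (· ∈ S)) (fun z => by simp)]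
    refine Finset.sum_congr rfl fun s _ => ?_
    rw [dif_pos s.2]
    rfl

/-- The coefficients of `a` along the line through `s` parallel to `v`. -/
noncomputable def lineCoeff {v : ℤ × ℤ} (hv : IsCoprime v.1 v.2) (a : ℤ × ℤ →₀ ℂ) (s : ℤ × ℤ) :
    ℤ →₀ ℂ :=
  a.comapDomain (fun j : ℤ => s + j • v) (add_smul_injective hv s).injOn

theorem lineCoeff_apply {v : ℤ × ℤ} (hv : IsCoprime v.1 v.2) (a : ℤ × ℤ →₀ ℂ) (s : ℤ × ℤ)
    (j : ℤ) : lineCoeff hv a s j = a (s + j • v) := rfl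

theorem lineCoeff_ne_zero {v : ℤ × ℤ} (hv : IsCoprime v.1 v.2) {a : ℤ × ℤ →₀ ℂ} {s : ℤ × ℤ}
    (hs : s ∈ a.support) : lineCoeff hv a s ≠ 0 := fun h => by
  have := DFunLike.congr_fun h 0
  rw [lineCoeff_apply, zero_smul, add_zero] at this
  exact Finsupp.mem_support_iff.1 hs this

/-- If `a` annihilates a function that vanishes strictly above some level, then the bottom
coefficients of `a` annihilate this level. -/
theorem Annihilates.lineCoeff_sum {v : ℤ × ℤ} (hv : IsCoprime v.1 v.2) {a : ℤ × ℤ →₀ ℂ}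
    {u : ℤ × ℤ → ℂ} (h : Annihilates a 0 u) {γ β : ℤ}
    (ha : ∀ s ∈ a.support, γ ≤ lev v s ∧ lev v s ≤ β) {s₁ : ℤ × ℤ} (hs₁ : lev v s₁ = γ) {μ : ℤ}
    (hu : ∀ z, μ < lev v z → lev v z ≤ μ + (β - γ) → u z = 0) {z₀ : ℤ × ℤ} (hz₀ : lev v z₀ = μ)
    (k : ℤ) : (lineCoeff hv a s₁).sum (fun j α => α * u (z₀ + (k + j) • v)) = 0 := by
  rw [← h (z₀ + k • v - s₁)]
  refine Finset.sum_of_injOn (fun j : ℤ => s₁ + j • v) (add_smul_injective hv s₁).injOn ?_ ?_ ?_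
  · intro j hj
    simpa [lineCoeff_apply] using hj
  · intro s hs hns
    have hlt : γ < lev v s := by
      refine lt_of_le_of_ne (ha s hs).1 fun heq => hns ?_
      obtain ⟨j, rfl⟩ := eq_add_smul_of_lev_eq hv (x := s) (y := s₁) (by rw [hs₁, heq])
      refine ⟨j, ?_, rfl⟩
      simpa [lineCoeff_apply] using hs
    have := (ha s hs).2
    refine mul_eq_zero_of_right _ (hu _ ?_ ?_)
    · simp only [lev_add, lev_sub, lev_smul, lev_self]; omega
    · simp only [lev_add, lev_sub, lev_smul, lev_self]; omega
  · intro j _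
    have e : s₁ + j • v + (z₀ + k • v - s₁) = z₀ + (k + j) • v := by module
    simp only [lineCoeff_apply, e]

theorem eq_zero_of_forall_add_mul_mem {D : Set ℂ} (hD : D.Finite) {x y : ℂ}
    (h : ∀ k : ℕ, x + k * y ∈ D) : y = 0 := by
  by_contra hy
  refine Set.infinite_of_injective_forall_mem (f := fun k : ℕ => x + k * y) (fun i j hij => ?_) h hD
  exact_mod_cast mul_right_cancel₀ hy (add_left_cancel hij)

/-- Periodicity along `v` of a finite-valued function that satisfies a linear relation passes to the
level below. -/
theorem exists_period_level_below {v : ℤ × ℤ} (hv : IsCoprime v.1 v.2) {a : ℤ × ℤ →₀ ℂ}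
    {γ β : ℤ} (ha : ∀ s ∈ a.support, γ ≤ lev v s ∧ lev v s ≤ β)
    (hγ : ∃ s ∈ a.support, lev v s = γ) {D : Set ℂ} (hD : D.Finite) :
    ∃ M : ℕ, 1 ≤ M ∧ ∀ N : ℕ, M ∣ N → ∀ u : ℤ × ℤ → ℂ, (∀ z, u z ∈ D) →
      ∀ c, Annihilates a c u → ∀ μ,
      (∀ z, μ < lev v z → lev v z ≤ μ + (β - γ) → u (z + (N : ℤ) • v) = u z) →
      ∀ z, lev v z = μ → u (z + (N : ℤ) • v) = u z := by
  obtain ⟨s₁, hs₁, hlev⟩ := hγ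
  obtain ⟨M, hM1, hM⟩ := exists_common_period (lineCoeff hv a s₁) (lineCoeff_ne_zero hv hs₁)
    (hD.image2 (· - ·) hD)
  refine ⟨M, hM1, fun N hMN u hu c hc μ hμ z hz => ?_⟩
  set ζ : ℤ × ℤ → ℂ := fun z => u (z + (N : ℤ) • v) - u z with hζdef
  have hζ0 : Annihilates a 0 ζ := by
    have := (hc.comp_add ((N : ℤ) • v)).sub hc
    rwa [sub_self] at this
  have hper := hM (fun k => ζ (z + k • v)) (fun k => ⟨_, hu _, _, hu _, rfl⟩)
    (fun k => hζ0.lineCoeff_sum hv ha hlev (fun z h1 h2 => sub_eq_zero.2 (hμ z h1 h2)) hz k)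
  obtain ⟨m, rfl⟩ := hMN
  have hstep : ∀ k : ℕ, u (z + ((k * (M * m) : ℕ) : ℤ) • v) = u z + k * ζ z := by
    intro k
    induction k with
    | zero => simp
    | succ k ih =>
      have h1 := periodic_mul (x := fun k => ζ (z + k • v)) hper (k * m) 0
      simp only [zero_add, zero_smul, add_zero] at h1
      have h2 : u (z + (((k + 1) * (M * m) : ℕ) : ℤ) • v) =
          u (z + ((k * (M * m) : ℕ) : ℤ) • v) + ζ (z + ((k : ℤ) * m * M) • v) := by
        rw [hζdef]
        have e1 : z + ((k : ℤ) * m * M) • v = z + ((k * (M * m) : ℕ) : ℤ) • v := by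
          congr 2; push_cast; ring
        have e2 : z + ((k * (M * m) : ℕ) : ℤ) • v + ((M * m : ℕ) : ℤ) • v =
            z + (((k + 1) * (M * m) : ℕ) : ℤ) • v := by
          rw [add_assoc, ← add_smul]; congr 2; push_cast; ring
        simp only [e1, e2]
        ring
      rw [h2, h1, ih]
      push_cast
      ring
  have : ζ z = 0 := eq_zero_of_forall_add_mul_mem hD fun k => by rw [← hstep]; exact hu _
  exact sub_eq_zero.1 this

/-- Periodicity along `v` of a finite-valued function that satisfies a linear relation passes from
sufficiently many consecutive levels to all levels. -/
theorem exists_period_of_levels {v : ℤ × ℤ} (hv : IsCoprime v.1 v.2) {a : ℤ × ℤ →₀ ℂ}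
    {γ β : ℤ} (ha : ∀ s ∈ a.support, γ ≤ lev v s ∧ lev v s ≤ β)
    (hγ : ∃ s ∈ a.support, lev v s = γ) (hβ : ∃ s ∈ a.support, lev v s = β)
    {D : Set ℂ} (hD : D.Finite) :
    ∃ M : ℕ, 1 ≤ M ∧ ∀ N : ℕ, M ∣ N → ∀ u : ℤ × ℤ → ℂ, (∀ z, u z ∈ D) →
      ∀ c, Annihilates a c u → ∀ μ,
      (∀ z, μ < lev v z → lev v z ≤ μ + (β - γ) → u (z + (N : ℤ) • v) = u z) →
      ∀ z, u (z + (N : ℤ) • v) = u z := by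
  obtain ⟨M₁, hM₁, H₁⟩ := exists_period_level_below hv ha hγ hD
  obtain ⟨M₂, hM₂, H₂⟩ := exists_period_level_below (v := -v) (a := a) (γ := -β) (β := -γ)
    (by simpa using hv.neg_neg) (fun s hs => by
      have := ha s hs
      simp only [lev_neg_left]; omega) (by simpa using hβ) hD
  refine ⟨M₁ * M₂, Nat.mul_pos hM₁ hM₂, fun N hN u hu c hc μ hμ => ?_⟩
  have hdown : ∀ n : ℕ, ∀ z, μ - n < lev v z → lev v z ≤ μ + (β - γ) →
      u (z + (N : ℤ) • v) = u z := by
    intro n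
    induction n with
    | zero => simpa using hμ
    | succ n ih =>
      intro z h1 h2
      by_cases h3 : μ - n < lev v z
      · exact ih z h3 h2
      · refine H₁ N ((dvd_mul_right _ _).trans hN) u hu c hc (μ - n) (fun z h4 h5 => ?_) z (by
          push_cast at h1; omega)
        exact ih z h4 (by omega)
  have hdown' : ∀ z, lev v z ≤ μ + (β - γ) → u (z + (N : ℤ) • v) = u z := fun z hz =>
    hdown (μ - lev v z + 1).toNat z (by omega) hz
  have hup : ∀ n : ℕ, ∀ z, lev v z ≤ μ + (β - γ) + n → u (z + (N : ℤ) • v) = u z := by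
    intro n
    induction n with
    | zero => simpa using hdown'
    | succ n ih =>
      intro z h1
      by_cases h3 : lev v z ≤ μ + (β - γ) + n
      · exact ih z h3
      · have := H₂ N ((dvd_mul_left _ _).trans hN) u hu c hc (-lev v z) (fun y h4 h5 => ?_)
          (z + (N : ℤ) • v) (by
            simp only [lev_neg_left, lev_add, lev_smul, lev_self, neg_zero, mul_zero, add_zero])
        · rw [← this]; congr 1; module
        · simp only [lev_neg_left] at h4
          rw [← ih (y + (N : ℤ) • (-v)) (by
            simp only [lev_add, lev_smul, smul_neg, lev_self, mul_zero, ← neg_smul]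
            push_cast at h1; omega)]
          congr 1; module
  exact fun z => hup (lev v z - (μ + (β - γ))).toNat z (by omega)

theorem exists_root_of_unity_eval_ne_zero {N : ℕ} (hN : 1 ≤ N) (x : ℕ → ℂ) (hx : x 0 ≠ 0) :
    ∃ ω : ℂ, ω ^ N = 1 ∧ ∑ k ∈ Finset.range N, x k * ω ^ k ≠ 0 := by
  by_contra! hcon
  set E : Polynomial ℂ := ∑ k ∈ Finset.range N, Polynomial.C (x k) * Polynomial.X ^ k with hE
  have hprim := Complex.isPrimitiveRoot_exp N (by omega)
  have hE0 : E = 0 := by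
    apply Polynomial.eq_zero_of_natDegree_lt_card_of_eval_eq_zero' E
      (Polynomial.nthRootsFinset N (1 : ℂ))
    · intro ω hω
      rw [Polynomial.mem_nthRootsFinset hN] at hω
      rw [hE, Polynomial.eval_finsetSum]
      simpa using hcon ω hω
    · rw [hprim.card_nthRootsFinset]
      refine (Polynomial.natDegree_sum_le_of_forall_le (n := N - 1) _ _ fun k hk => ?_).trans_lt
        (by omega)
      refine (Polynomial.natDegree_C_mul_X_pow_le _ _).trans ?_
      have := Finset.mem_range.1 hk
      omega
  apply hx
  have : E.coeff 0 = x 0 := by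
    rw [hE, Polynomial.finsetSum_coeff, Finset.sum_eq_single 0]
    · simp
    · intro k _ hk
      simp [Polynomial.coeff_X_pow, hk.symm]
    · intro h; simp at h; omega
  rw [← this, hE0, Polynomial.coeff_zero]

/-- The Fourier coefficient of `u` along `v` at the `N`-th root of unity `ω`. -/
noncomputable def fourierAlong (v : ℤ × ℤ) (N : ℕ) (ω : ℂ) (u : ℤ × ℤ → ℂ) (z : ℤ × ℤ) : ℂ :=
  ∑ k ∈ Finset.range N, u (z + (k : ℤ) • v) * ω ^ k

theorem fourierAlong_add {v : ℤ × ℤ} {N : ℕ} {ω : ℂ} (hω : ω ^ N = 1)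
    {u : ℤ × ℤ → ℂ} (hu : ∀ z, u (z + (N : ℤ) • v) = u z) (z : ℤ × ℤ) :
    fourierAlong v N ω u z = ω * fourierAlong v N ω u (z + v) := by
  have h1 := Finset.sum_range_succ (fun k : ℕ => u (z + (k : ℤ) • v) * ω ^ k) N
  rw [Finset.sum_range_succ', hu, hω] at h1
  simp only [Nat.cast_zero, zero_smul, add_zero, pow_zero] at h1
  have h2 := add_right_cancel h1
  rw [fourierAlong, fourierAlong, ← h2, Finset.mul_sum]
  refine Finset.sum_congr rfl fun k _ => ?_
  rw [show z + ((k + 1 : ℕ) : ℤ) • v = z + v + (k : ℤ) • v by push_cast; module]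
  ring

theorem fourierAlong_add_smul {v : ℤ × ℤ} {N : ℕ} (hN : 1 ≤ N) {ω : ℂ} (hω : ω ^ N = 1)
    {u : ℤ × ℤ → ℂ} (hu : ∀ z, u (z + (N : ℤ) • v) = u z) (z : ℤ × ℤ) (k : ℤ) :
    fourierAlong v N ω u (z + k • v) = ω ^ (-k) * fourierAlong v N ω u z := by
  have hω0 : ω ≠ 0 := by
    rintro rfl
    rw [zero_pow (by omega)] at hω
    exact zero_ne_one hω
  have hstep : ∀ z, fourierAlong v N ω u (z + v) = ω⁻¹ * fourierAlong v N ω u z := fun z => by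
    rw [fourierAlong_add hω hu z, inv_mul_cancel_left₀ hω0]
  induction k using Int.induction_on with
  | zero => simp
  | succ k ih =>
    rw [add_smul, one_smul, ← add_assoc, hstep, ih, neg_add, zpow_add₀ hω0, zpow_neg_one]
    ring
  | pred k ih =>
    have := hstep (z + (-(k : ℤ) - 1) • v)
    rw [show z + (-(k : ℤ) - 1) • v + v = z + (-(k : ℤ)) • v by module, ih] at this
    rw [neg_sub, sub_neg_eq_add, add_comm, zpow_add₀ hω0]
    rw [neg_neg] at this
    field_simp at this
    rw [add_comm] at this
    rw [zpow_one, mul_assoc, mul_comm, ← this]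

theorem Annihilates.fourier {v : ℤ × ℤ} {N : ℕ} {ω : ℂ} {a : ℤ × ℤ →₀ ℂ}
    {u : ℤ × ℤ → ℂ} (h : Annihilates a 0 u) : Annihilates a 0 (fourierAlong v N ω u) := fun x => by
  have : ∀ k : ℕ, a.sum (fun s α => α * u (s + (x + (k : ℤ) • v))) * ω ^ k = 0 := fun k => by
    rw [h, zero_mul]
  rw [← Finset.sum_eq_zero fun k (_ : k ∈ Finset.range N) => this k]
  simp only [Finsupp.sum, fourierAlong, Finset.mul_sum, Finset.sum_mul]
  rw [Finset.sum_comm]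
  refine Finset.sum_congr rfl fun k _ => Finset.sum_congr rfl fun s _ => ?_
  rw [← add_assoc]
  ring

/-- If `a` annihilates a nonzero `v`-periodic function that vanishes above some level, then no
level contains exactly one point of the support of `a`. -/
theorem Annihilates.exists_ne_mem_support {v : ℤ × ℤ} (hv : IsCoprime v.1 v.2) {a : ℤ × ℤ →₀ ℂ}
    {u : ℤ × ℤ → ℂ} (h : Annihilates a 0 u) {N : ℕ} (hN : 1 ≤ N)
    (hu : ∀ z, u (z + (N : ℤ) • v) = u z) {z₀ : ℤ × ℤ} (hz₀ : u z₀ ≠ 0)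
    (hup : ∀ z, lev v z₀ < lev v z → u z = 0) {s : ℤ × ℤ} (hs : s ∈ a.support) :
    ∃ s' ∈ a.support, s' ≠ s ∧ lev v s' = lev v s := by
  classical
  obtain ⟨ω, hω, hne⟩ := exists_root_of_unity_eval_ne_zero hN
    (fun k : ℕ => u (z₀ + (k : ℤ) • v)) (by simpa using hz₀)
  set U := fourierAlong v N ω u with hU
  have hUz₀ : U z₀ ≠ 0 := hne
  have hann : Annihilates a 0 U := h.fourier
  have hUup : ∀ z, lev v z₀ < lev v z → U z = 0 := fun z hz => by
    refine Finset.sum_eq_zero fun k _ => ?_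
    rw [hup _ (by simpa only [lev_add, lev_smul, lev_self, mul_zero, add_zero]), zero_mul]
  set G : ℤ → ℤ × ℤ → ℂ := fun i x => ∑ s ∈ a.support with lev v s = i, a s * U (s + x) with hG
  have hfactor : ∀ (s₁ x : ℤ × ℤ), ∃ P : ℂ, ∀ x, G (lev v s₁) x = P * U (s₁ + x) := by
    intro s₁ x
    have : ∀ s : ℤ × ℤ, ∃ k : ℤ, lev v s = lev v s₁ → s = s₁ + k • v := fun s => by
      by_cases hs : lev v s = lev v s₁
      · obtain ⟨k, hk⟩ := eq_add_smul_of_lev_eq hv hs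
        exact ⟨k, fun _ => hk⟩
      · exact ⟨0, fun h => absurd h hs⟩
    choose κ hκ using this
    refine ⟨∑ s ∈ a.support with lev v s = lev v s₁, a s * ω ^ (-κ s), fun x => ?_⟩
    rw [hG, Finset.sum_mul]
    refine Finset.sum_congr rfl fun s hs => ?_
    have hk := hκ s (Finset.mem_filter.1 hs).2
    have : s + x = s₁ + x + κ s • v := by
      conv_lhs => rw [hk]
      abel
    rw [this, hU, fourierAlong_add_smul hN hω hu]
    ring
  have hzero : ∀ s ∈ a.support, ∀ x, G (lev v s) x = 0 := by
    by_contra! hcon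
    obtain ⟨s₀, hs₀, x₀, hx₀⟩ := hcon
    obtain ⟨s₁, hs₁, hmin⟩ := Finset.exists_min_image
      (a.support.filter fun s => ∃ x, G (lev v s) x ≠ 0) (lev v)
      ⟨s₀, Finset.mem_filter.2 ⟨hs₀, x₀, hx₀⟩⟩
    obtain ⟨hs₁s, x₁, hx₁⟩ := Finset.mem_filter.1 hs₁
    obtain ⟨P, hP⟩ := hfactor s₁ 0
    have hsum := hann (z₀ - s₁)
    rw [Finsupp.sum, ← Finset.sum_fiberwise_of_maps_to
      (fun s hs => Finset.mem_image_of_mem (lev v) hs)] at hsum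
    have h1 : G (lev v s₁) (z₀ - s₁) = 0 := by
      rw [← hsum]
      symm
      refine Finset.sum_eq_single (lev v s₁) (fun i hi hne => ?_) (fun h => absurd
        (Finset.mem_image_of_mem _ hs₁s) h)
      obtain ⟨s, hs, rfl⟩ := Finset.mem_image.1 hi
      rcases lt_or_gt_of_ne hne with hlt | hgt
      · by_contra hcon
        have := hmin s (Finset.mem_filter.2 ⟨hs, _, hcon⟩)
        omega
      · refine Finset.sum_eq_zero fun t ht => ?_
        have := (Finset.mem_filter.1 ht).2
        rw [hUup, mul_zero]
        simp only [lev_add, lev_sub]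
        omega
    rw [hP, add_sub_cancel] at h1
    rw [hP, (mul_eq_zero.1 h1).resolve_right hUz₀, zero_mul] at hx₁
    exact hx₁ rfl
  by_contra! hcon
  have h1 := hzero s hs (z₀ - s)
  rw [hG] at h1
  simp only at h1
  rw [Finset.sum_eq_single s] at h1
  · rw [add_sub_cancel] at h1
    exact (mul_ne_zero (Finsupp.mem_support_iff.1 hs) hUz₀) h1
  · intro t ht hne
    exact absurd (Finset.mem_filter.1 ht).2 (hcon t (Finset.mem_filter.1 ht).1 hne)
  · intro hns
    exact (hns (Finset.mem_filter.2 ⟨hs, rfl⟩)).elim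

theorem rect_finite (n k : ℕ) : (rect n k).Finite := by
  refine (Set.finite_Icc ((0 : ℤ), (0 : ℤ)) ((n : ℤ), (k : ℤ))).subset fun z hz => ?_
  exact ⟨⟨hz.1, hz.2.2.1⟩, ⟨hz.2.1.le, hz.2.2.2.le⟩⟩

theorem ncard_rect (n k : ℕ) : (rect n k).ncard = n * k := by
  have : rect n k = (Finset.Ico (0 : ℤ) n ×ˢ Finset.Ico (0 : ℤ) k : Finset (ℤ × ℤ)) := by
    ext z; simp [rect, and_assoc]
  rw [this, Set.ncard_coe_finset, Finset.card_product]
  simp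

theorem rect_convex {n k : ℕ} {x v : ℤ × ℤ} (hx : x ∈ rect n k) {j l : ℤ}
    (hy : x + l • v ∈ rect n k) (hj : 0 ≤ j) (hjl : j ≤ l) : x + j • v ∈ rect n k := by
  simp only [rect, Set.mem_ofPred_eq, Prod.fst_add, Prod.snd_add, Prod.smul_fst, Prod.smul_snd,
    smul_eq_mul] at *
  obtain ⟨h1, h2, h3, h4⟩ := hx
  obtain ⟨h5, h6, h7, h8⟩ := hy
  have key : ∀ a b N : ℤ, 0 ≤ a → a < N → 0 ≤ a + l * b → a + l * b < N →
      0 ≤ a + j * b ∧ a + j * b < N := by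
    intro a b N ha ha' hb hb'
    rcases le_total 0 b with h | h
    · have := mul_le_mul_of_nonneg_right hjl h
      have := mul_nonneg hj h
      constructor <;> linarith
    · have := mul_le_mul_of_nonpos_right hjl h
      have := mul_nonpos_of_nonneg_of_nonpos hj h
      constructor <;> linarith
  have k1 := key x.1 v.1 n h1 h2 h5 h6
  have k2 := key x.2 v.2 k h3 h4 h7 h8
  exact ⟨k1.1, k1.2, k2.1, k2.2⟩

/-- A finite set of points of a line parallel to `v` without gaps consists of consecutive points. -/
theorem exists_consecutive {v : ℤ × ℤ} (hv : IsCoprime v.1 v.2) {W : Set (ℤ × ℤ)} (hW : W.Finite)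
    (hne : W.Nonempty) (hlev : ∀ x ∈ W, ∀ y ∈ W, lev v x = lev v y)
    (hconv : ∀ x ∈ W, ∀ j l : ℤ, x + l • v ∈ W → 0 ≤ j → j ≤ l → x + j • v ∈ W) :
    ∃ q, ∀ j : ℤ, q + j • v ∈ W ↔ 0 ≤ j ∧ j < W.ncard := by
  obtain ⟨x₀, hx₀⟩ := hne
  set K : Set ℤ := (fun j : ℤ => x₀ + j • v) ⁻¹' W with hK
  have hKfin : K.Finite := hW.preimage (add_smul_injective hv x₀).injOn
  have hK0 : (0 : ℤ) ∈ K := by simpa [hK] using hx₀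
  obtain ⟨a, ha, hamin⟩ := Set.exists_min_image K id hKfin ⟨0, hK0⟩
  obtain ⟨b, hb, hbmax⟩ := Set.exists_max_image K id hKfin ⟨0, hK0⟩
  have hWK : W = (fun j : ℤ => x₀ + j • v) '' K := by
    rw [hK, Set.image_preimage_eq_of_subset]
    intro y hy
    obtain ⟨k, hk⟩ := eq_add_smul_of_lev_eq hv (hlev y hy x₀ hx₀)
    exact ⟨k, hk.symm⟩
  have hKI : K = Set.Icc a b := by
    ext j
    refine ⟨fun hj => ⟨hamin j hj, hbmax j hj⟩, fun hj => ?_⟩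
    have := hconv _ ha (j - a) (b - a) (by
      rw [show x₀ + a • v + (b - a) • v = x₀ + b • v by module]; exact hb)
      (by have := hj.1; omega) (by have := hj.2; omega)
    rwa [show x₀ + a • v + (j - a) • v = x₀ + j • v by module] at this
  have hcard : (W.ncard : ℤ) = b - a + 1 := by
    rw [hWK, Set.ncard_image_of_injective _ (add_smul_injective hv x₀), hKI,
      ← Finset.coe_Icc, Set.ncard_coe_finset, Int.card_Icc]
    have := hamin b hb
    simp only [id] at this
    omega
  refine ⟨x₀ + a • v, fun j => ?_⟩
  have : x₀ + a • v + j • v ∈ W ↔ a + j ∈ K := by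
    rw [show x₀ + a • v + j • v = x₀ + (a + j) • v by module]; rfl
  rw [this, hKI, hcard, Set.mem_Icc]
  omega

theorem mem_Ico_of_weighted {L X N x₁ x₂ x₃ x₄ A₁ A₂ A₃ A₄ : ℤ} (hL : 0 < L)
    (h₁ : 0 ≤ x₁ ∧ x₁ < N) (h₂ : 0 ≤ x₂ ∧ x₂ < N) (h₃ : 0 ≤ x₃ ∧ x₃ < N) (h₄ : 0 ≤ x₄ ∧ x₄ < N)
    (hA₁ : 0 ≤ A₁) (hA₂ : 0 ≤ A₂) (hA₃ : 0 ≤ A₃) (hA₄ : 0 ≤ A₄) (hA : A₁ + A₂ + A₃ + A₄ = L)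
    (hX : L * X = A₁ * x₁ + A₂ * x₂ + A₃ * x₃ + A₄ * x₄) : 0 ≤ X ∧ X < N := by
  constructor
  · have : 0 ≤ L * X := by
      rw [hX]
      have := mul_nonneg hA₁ h₁.1
      have := mul_nonneg hA₂ h₂.1
      have := mul_nonneg hA₃ h₃.1
      have := mul_nonneg hA₄ h₄.1
      linarith
    exact nonneg_of_mul_nonneg_right this hL
  · have : L * X ≤ L * (N - 1) := by
      rw [hX, ← hA]
      have := mul_le_mul_of_nonneg_left (Int.le_sub_one_of_lt h₁.2) hA₁
      have := mul_le_mul_of_nonneg_left (Int.le_sub_one_of_lt h₂.2) hA₂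
      have := mul_le_mul_of_nonneg_left (Int.le_sub_one_of_lt h₃.2) hA₃
      have := mul_le_mul_of_nonneg_left (Int.le_sub_one_of_lt h₄.2) hA₄
      linarith
    have := le_of_mul_le_mul_left this hL
    omega

/-- Every level between two levels with consecutive points of a rectangle meets the rectangle. -/
theorem exists_mem_rect_lev_eq {n k : ℕ} {v : ℤ × ℤ} (hv : IsCoprime v.1 v.2) {x y : ℤ × ℤ}
    (hx : x ∈ rect n k) (hxv : x + v ∈ rect n k) (hy : y ∈ rect n k) (hyv : y + v ∈ rect n k)
    {i : ℤ} (h1 : lev v x < i) (h2 : i ≤ lev v y) : ∃ q ∈ rect n k, lev v q = i := by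
  obtain ⟨e, he⟩ := exists_lev_eq_one hv
  set L := lev v y - lev v x with hL
  set I := i - lev v x with hI
  have hLpos : 0 < L := by omega
  obtain ⟨σ, hσ⟩ := eq_add_smul_of_lev_eq hv (x := y) (y := x + L • e) (by
    simp only [lev_add, lev_smul, he]; omega)
  set K := -((-(I * σ)) / L) with hK
  set ρ := L * K - I * σ with hρ
  have hρ' : ρ = (-(I * σ)) % L := by
    rw [Int.emod_def]; simp only [hρ, hK]; ring
  have hρ0 : 0 ≤ ρ := hρ' ▸ Int.emod_nonneg _ hLpos.ne'
  have hρL : ρ < L := hρ' ▸ Int.emod_lt_of_pos _ hLpos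
  have hc1 : y.1 = x.1 + L * e.1 + σ * v.1 := by rw [hσ]; simp
  have hc2 : y.2 = x.2 + L * e.2 + σ * v.2 := by rw [hσ]; simp
  refine ⟨x + I • e + K • v, ?_, by simp only [lev_add, lev_smul, he, lev_self]; omega⟩
  have w1 : 0 ≤ (L - I) * (L - ρ) := mul_nonneg (by omega) (by omega)
  have w2 : 0 ≤ (L - I) * ρ := mul_nonneg (by omega) (by omega)
  have w3 : 0 ≤ I * (L - ρ) := mul_nonneg (by omega) (by omega)
  have w4 : 0 ≤ I * ρ := mul_nonneg (by omega) (by omega)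
  have hsum : (L - I) * (L - ρ) + (L - I) * ρ + I * (L - ρ) + I * ρ = L * L := by ring
  have k1 := mem_Ico_of_weighted (X := (x + I • e + K • v).1) (mul_pos hLpos hLpos)
    ⟨hx.1, hx.2.1⟩ ⟨hxv.1, hxv.2.1⟩ ⟨hy.1, hy.2.1⟩ ⟨hyv.1, hyv.2.1⟩ w1 w2 w3 w4 hsum (by
      simp only [Prod.fst_add, Prod.smul_fst, smul_eq_mul, hc1]
      rw [hρ]; ring)
  have k2 := mem_Ico_of_weighted (X := (x + I • e + K • v).2) (mul_pos hLpos hLpos)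
    ⟨hx.2.2.1, hx.2.2.2⟩ ⟨hxv.2.2.1, hxv.2.2.2⟩ ⟨hy.2.2.1, hy.2.2.2⟩ ⟨hyv.2.2.1, hyv.2.2.2⟩
    w1 w2 w3 w4 hsum (by
      simp only [Prod.snd_add, Prod.smul_snd, smul_eq_mul, hc2]
      rw [hρ]; ring)
  exact ⟨k1.1, k1.2, k2.1, k2.2⟩

/-- If a level contains `m + 1 ≥ 2` consecutive points of a rectangle of height three and a higher
one contains two of them, then all levels between contain `m` consecutive points. -/
theorem exists_consecutive_rect {n m : ℕ} (hm : 1 ≤ m) {v : ℤ × ℤ} (hv : IsCoprime v.1 v.2)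
    {x y : ℤ × ℤ} (hx : x ∈ rect n 3) (hxv : x + (m : ℤ) • v ∈ rect n 3)
    (hy : y ∈ rect n 3) (hyv : y + v ∈ rect n 3) {i : ℤ} (h1 : lev v x < i) (h2 : i ≤ lev v y) :
    ∃ q, lev v q = i ∧ ∀ j : ℕ, j < m → q + (j : ℤ) • v ∈ rect n 3 := by
  have hxv1 : x + v ∈ rect n 3 := by
    simpa using rect_convex hx hxv (j := 1) (by omega) (by exact_mod_cast hm)
  by_cases hm1 : m = 1
  · obtain ⟨q, hq, hqi⟩ := exists_mem_rect_lev_eq hv hx hxv1 hy hyv h1 h2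
    refine ⟨q, hqi, fun j hj => ?_⟩
    obtain rfl : j = 0 := by omega
    simpa using hq
  obtain ⟨x₁, x₂⟩ := x
  obtain ⟨y₁, y₂⟩ := y
  obtain ⟨a, b⟩ := v
  simp only [rect, Set.mem_ofPred_eq, Prod.fst_add, Prod.snd_add, Prod.smul_fst, Prod.smul_snd,
    smul_eq_mul, Nat.cast_ofNat, lev] at *
  obtain ⟨hx1, hx2, hx3, hx4⟩ := hx
  obtain ⟨hy1, hy2, hy3, hy4⟩ := hy
  obtain ⟨hxv1, hxv2, hxv3, hxv4⟩ := hxv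
  obtain ⟨hyv1, hyv2, hyv3, hyv4⟩ := hyv
  rcases eq_or_ne b 0 with rfl | h0
  · refine ⟨(x₁, a * i), ?_, fun j hj => ?_⟩
    · rcases Int.isUnit_iff.1 (isCoprime_zero_right.1 hv) with rfl | rfl <;> simp
    · have hjm : (j : ℤ) < m := by exact_mod_cast hj
      rcases Int.isUnit_iff.1 (isCoprime_zero_right.1 hv) with rfl | rfl <;>
        refine ⟨?_, ?_, ?_, ?_⟩ <;> simp only at * <;> omega
  · have hm2 : 2 ≤ (m : ℤ) := by omega
    have hb : (b = 1 ∨ b = -1) ∧ (m : ℤ) = 2 := by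
      rcases lt_or_gt_of_ne h0 with h | h
      · have : (m : ℤ) * (-b) ≤ 2 := by linarith
        have h3 : -b = 1 := by nlinarith
        refine ⟨Or.inr (by omega), ?_⟩
        rw [h3] at this; omega
      · have : (m : ℤ) * b ≤ 2 := by linarith
        have h3 : b = 1 := by nlinarith
        refine ⟨Or.inl h3, ?_⟩
        rw [h3] at this; omega
    obtain ⟨hb, hmeq⟩ := hb
    rw [hmeq] at hxv1 hxv2 hxv3 hxv4
    refine ⟨(b * (a * y₂ - i), y₂), ?_, fun j hj => ?_⟩
    · rcases hb with rfl | rfl <;> simp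
    · have hj' : (j : ℤ) = 0 ∨ (j : ℤ) = 1 := by omega
      interval_cases x₂ <;> interval_cases y₂ <;> rcases hb with rfl | rfl <;>
        rcases hj' with h | h <;> rw [h] <;> refine ⟨?_, ?_, ?_, ?_⟩ <;> simp only at * <;> omega

/-- The points of the rectangle on or above a level. -/
def rectAbove (v : ℤ × ℤ) (n : ℕ) (c : ℤ) : Set (ℤ × ℤ) := {z ∈ rect n 3 | c ≤ lev v z}

/-- The points of the rectangle on a level. -/
def rectLevel (v : ℤ × ℤ) (n : ℕ) (c : ℤ) : Set (ℤ × ℤ) := {z ∈ rect n 3 | lev v z = c}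

theorem rectAbove_finite (v : ℤ × ℤ) (n : ℕ) (c : ℤ) : (rectAbove v n c).Finite :=
  (rect_finite n 3).subset fun _ h => h.1

theorem rectLevel_finite (v : ℤ × ℤ) (n : ℕ) (c : ℤ) : (rectLevel v n c).Finite :=
  (rect_finite n 3).subset fun _ h => h.1

theorem rectAbove_succ_subset (v : ℤ × ℤ) (n : ℕ) (c : ℤ) :
    rectAbove v n (c + 1) ⊆ rectAbove v n c := fun _ h => ⟨h.1, by have := h.2; omega⟩

theorem ncard_rectAbove (v : ℤ × ℤ) (n : ℕ) (c : ℤ) :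
    (rectAbove v n c).ncard = (rectAbove v n (c + 1)).ncard + (rectLevel v n c).ncard := by
  rw [← Set.ncard_union_eq _ (rectAbove_finite v n _) (rectLevel_finite v n c)]
  · congr 1
    ext z
    simp only [rectAbove, rectLevel, Set.mem_ofPred_eq, Set.mem_union]
    refine ⟨fun h => ?_, fun h => ?_⟩
    · rcases eq_or_lt_of_le h.2 with h' | h'
      · exact Or.inr ⟨h.1, h'.symm⟩
      · exact Or.inl ⟨h.1, h'⟩
    · rcases h with h | h <;> exact ⟨h.1, by have := h.2; omega⟩
  · rw [Set.disjoint_left]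
    intro z h1 h2
    have := h1.2; have := h2.2
    omega

theorem exists_rectAbove {A : Type*} {η : ℤ × ℤ → A} {v : ℤ × ℤ} {n : ℕ} (hη : complexity η (rect n 3) ≤ 3 * n) :
    ∃ c, complexity η (rectAbove v n c) ≤ (rectAbove v n c).ncard ∧
      (rectAbove v n (c + 1)).ncard < complexity η (rectAbove v n (c + 1)) := by
  obtain ⟨b, hb⟩ := ((rect_finite n 3).image (lev v)).bddBelow
  obtain ⟨B, hB⟩ := ((rect_finite n 3).image (lev v)).bddAbove
  obtain ⟨c, hc, hmax⟩ := Int.exists_greatest_of_bdd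
    (P := fun c => complexity η (rectAbove v n c) ≤ (rectAbove v n c).ncard)
    ⟨B, fun c hc => by
      by_contra hlt
      have : rectAbove v n c = ∅ := by
        refine Set.eq_empty_of_forall_notMem fun z hz => ?_
        have h1 := hz.2
        have h2 := hB ⟨z, hz.1, rfl⟩
        omega
      rw [this, complexity_empty, Set.ncard_empty] at hc
      omega⟩
    ⟨b, by
      have : rectAbove v n b = rect n 3 := by
        refine Set.Subset.antisymm (fun z hz => hz.1) fun z hz => ⟨hz, hb ⟨z, hz, rfl⟩⟩
      rw [this, ncard_rect]
      omega⟩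
  refine ⟨c, hc, ?_⟩
  by_contra! h
  have := hmax _ h
  omega

theorem sub_le_of_mem_rectLevel {v : ℤ × ℤ} (hv : IsCoprime v.1 v.2) {n m : ℕ} (hm : 1 ≤ m)
    {c : ℤ} {w w₀ : ℤ × ℤ} (hw : w ∈ rectLevel v n c)
    (hw₀ : ∀ j : ℤ, w₀ + j • v ∈ rectLevel v n c ↔ 0 ≤ j ∧ j < (m + 1 : ℕ)) {s : ℤ × ℤ} {i j : ℤ}
    (hi : s + i • v ∈ rect n 3) (hj : s + j • v ∈ rect n 3) : j - i ≤ (m + 1 : ℕ) := by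
  have hw0 : w₀ ∈ rectLevel v n c := by
    have := (hw₀ 0).2 (by omega)
    rwa [zero_smul, add_zero] at this
  obtain ⟨hi1, hi2, hi3, hi4⟩ := hi
  obtain ⟨hj1, hj2, hj3, hj4⟩ := hj
  simp only [Prod.fst_add, Prod.snd_add, Prod.smul_fst, Prod.smul_snd, smul_eq_mul,
    Nat.cast_ofNat] at *
  by_contra! hlt
  rcases eq_or_ne v.2 0 with h0 | h0
  · have key : ∀ x : ℤ, 0 ≤ x → x < n → ((x, w.2) : ℤ × ℤ) ∈ rectLevel v n c := fun x h1 h2 =>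
      ⟨⟨h1, h2, hw.1.2.2⟩, by have := hw.2; simp only [lev, h0] at this ⊢; linarith⟩
    have k1 := key _ hi1 hi2
    have k2 := key _ hj1 hj2
    obtain ⟨r, hr⟩ := eq_add_smul_of_lev_eq hv (k1.2.trans hw0.2.symm)
    have e2 : ((s.1 + j * v.1, w.2) : ℤ × ℤ) = w₀ + (r + (j - i)) • v := by
      rw [add_smul, ← add_assoc, ← hr]
      ext <;> simp [h0]
      ring
    rw [hr, hw₀] at k1
    rw [e2, hw₀] at k2
    omega
  · push_cast at hlt
    have h3 : 3 ≤ j - i := by omega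
    rcases lt_or_gt_of_ne h0 with h | h <;> nlinarith

section

variable {A : Type*} [Finite A] [TopologicalSpace A] [DiscreteTopology A] {η f g : ℤ × ℤ → A}

theorem complexity_mono (η : ℤ × ℤ → A) {S' S : Set (ℤ × ℤ)} (hS : S.Finite) (h : S' ⊆ S) :
    complexity η S' ≤ complexity η S := by
  have := ncard_wordsAt_le (η := η) (f := η) (subset_closure ⟨0, by funext x; simp [shift]⟩) hS h ∅
  simpa [wordsAt] using this

/-- A recurrent periodic sequence that vanishes on a sufficiently long block vanishes. -/
theorem eq_zero_of_recurrence {q : ℤ →₀ ℂ} (hq : q ≠ 0) {ζ : ℤ → ℂ} {N : ℕ} (hN : 1 ≤ N)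
    (hper : ∀ k, ζ (k + N) = ζ k) (hrec : ∀ k, q.sum (fun j α => α * ζ (k + j)) = 0)
    {l : ℕ} (hl : ∀ i ∈ q.support, ∀ j ∈ q.support, j - i ≤ l) {k₀ : ℤ}
    (hz : ∀ i : ℕ, i < l → ζ (k₀ + i) = 0) (k : ℤ) : ζ k = 0 := by
  have hne : q.support.Nonempty := Finsupp.support_nonempty_iff.2 hq
  set t := q.support.max' hne with ht
  have hfwd : ∀ n : ℕ, ζ (k₀ + n) = 0 := by
    intro n
    induction n using Nat.strong_induction_on with
    | _ n ih =>
      by_cases hn : n < l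
      · exact hz n hn
      · have h1 := hrec (k₀ + n - t)
        rw [Finsupp.sum, Finset.sum_eq_single_of_mem t (Finset.max'_mem _ hne)] at h1
        · rw [sub_add_cancel] at h1
          exact (mul_eq_zero.1 h1).resolve_left
            (Finsupp.mem_support_iff.1 (Finset.max'_mem _ hne))
        · intro i hi hit
          have hle : i ≤ t := Finset.le_max' _ _ hi
          have hil := hl i hi t (Finset.max'_mem _ hne)
          obtain ⟨r, hr⟩ := Int.eq_ofNat_of_zero_le (a := n - (t - i)) (by omega)
          rw [show k₀ + n - t + i = k₀ + r by omega, ih r (by omega), mul_zero]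
  have h1 := periodic_mul (x := ζ) (p := N) hper |k - k₀| k
  have : |k - k₀| ≤ |k - k₀| * N := le_mul_of_one_le_right (abs_nonneg _) (by exact_mod_cast hN)
  have := neg_abs_le (k - k₀)
  obtain ⟨r, hr⟩ := Int.eq_ofNat_of_zero_le (a := k + |k - k₀| * N - k₀) (by omega)
  rw [← h1, show k + |k - k₀| * N = k₀ + r by omega]
  exact hfwd r

/-- Two distinct points of the orbit closure that agree above some level are periodic along the
levels. -/
theorem exists_period_of_agree {n : ℕ} (hη : complexity η (rect n 3) ≤ 3 * n) {v : ℤ × ℤ}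
    (hv : IsCoprime v.1 v.2) (hf : f ∈ orbitClosure η) (hg : g ∈ orbitClosure η) {z₀ : ℤ × ℤ}
    (hz₀ : f z₀ ≠ g z₀) (hag : ∀ z, lev v z₀ < lev v z → f z = g z) :
    ∃ N : ℕ, 1 ≤ N ∧ ∀ z, f (z + (N : ℤ) • v) = f z := by
  obtain ⟨c, hc, hc'⟩ := exists_rectAbove (v := v) hη
  have hcard := ncard_rectAbove v n c
  have hSfin := rectAbove_finite v n c
  have hsub := rectAbove_succ_subset v n c
  -- the level `c` of the rectangle
  have hmono := complexity_mono η hSfin hsub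
  obtain ⟨w, hw⟩ : (rectLevel v n c).Nonempty :=
    Set.nonempty_of_ncard_ne_zero (by omega)
  have hone := ncard_wordsAt_add_complexity_le hf hg (T := {z₀ - w}) hSfin hsub
    (by
      rintro _ rfl s hs
      refine hag _ ?_
      have h1 := hs.2; have h2 := hw.2
      simp only [lev_add, lev_sub]
      omega)
    (by
      rintro _ rfl
      exact ⟨w, ⟨hw.1, hw.2.ge⟩, by rwa [add_sub_cancel]⟩)
  rw [wordsAt, Set.image_singleton, Set.ncard_singleton] at hone
  obtain ⟨m, hm⟩ : ∃ m, (rectLevel v n c).ncard = m + 1 := ⟨_, (Nat.succ_pred (by omega)).symm⟩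
  have hm1 : 1 ≤ m := by omega
  have hlevfin := rectLevel_finite v n c
  obtain ⟨w₀, hw₀⟩ := exists_consecutive hv hlevfin ⟨w, hw⟩
    (fun x hx y hy => hx.2.trans hy.2.symm)
    (fun x hx j l hl h0 hjl => ⟨rect_convex hx.1 hl.1 h0 hjl, by
      simp only [lev_add, lev_smul, lev_self, mul_zero, add_zero]; exact hx.2⟩)
  rw [hm] at hw₀
  -- the annihilator
  obtain ⟨ι, hι⟩ := exists_injective_complex A
  obtain ⟨a, ha0, haS, κ, hκ⟩ := exists_annihilates ι hSfin hc
  have hne : a.support.Nonempty := Finsupp.support_nonempty_iff.2 ha0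
  obtain ⟨s₁, hs₁, hmin⟩ := Finset.exists_min_image a.support (lev v) hne
  obtain ⟨s₂, hs₂, hmax⟩ := Finset.exists_max_image a.support (lev v) hne
  set D := Set.range ι
  have hDfin : D.Finite := Set.finite_range ι
  have hbd : ∀ s ∈ a.support, lev v s₁ ≤ lev v s ∧ lev v s ≤ lev v s₂ := fun s hs =>
    ⟨hmin s hs, hmax s hs⟩
  obtain ⟨M₁, hM₁, H₁⟩ := exists_period_of_levels hv hbd ⟨s₁, hs₁, rfl⟩ ⟨s₂, hs₂, rfl⟩
    (hDfin.image2 (· - ·) hDfin)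
  obtain ⟨M₂, hM₂, H₂⟩ := exists_period_of_levels hv hbd ⟨s₁, hs₁, rfl⟩ ⟨s₂, hs₂, rfl⟩ hDfin
  -- the difference
  set e : ℤ × ℤ → ℂ := fun z => ι (f z) - ι (g z) with he
  have heann : Annihilates a 0 e := by
    have := (hκ f hf).sub (hκ g hg)
    rwa [sub_self] at this
  have he0 : ∀ z, lev v z₀ < lev v z → e z = 0 := fun z hz => by
    simp only [he, hag z hz, sub_self]
  have hez₀ : e z₀ ≠ 0 := sub_ne_zero.2 fun h => hz₀ (hι h)
  have heper := H₁ M₁ dvd_rfl e (fun z => ⟨_, ⟨_, rfl⟩, _, ⟨_, rfl⟩, rfl⟩) 0 heann (lev v z₀)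
    (fun z h1 _ => by
      rw [he0 _ h1, he0]
      simpa only [lev_add, lev_smul, lev_self, mul_zero, add_zero])
  -- the top level of the annihilator contains two consecutive points of the rectangle
  have hexists : ∃ y ∈ rect n 3, y + v ∈ rect n 3 ∧ lev v y = lev v s₂ := by
    obtain ⟨s', hs', hne', hlev'⟩ := heann.exists_ne_mem_support hv hM₁ heper hez₀ he0 hs₂
    obtain ⟨k, hk⟩ := eq_add_smul_of_lev_eq hv hlev'
    rcases lt_trichotomy k 0 with h | h | h
    · refine ⟨s', (haS s' hs').1, ?_, hlev'⟩
      have := rect_convex (x := s') (v := v) (l := -k) (haS s' hs').1 (by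
        rw [hk, show s₂ + k • v + -k • v = s₂ by module]; exact (haS s₂ hs₂).1)
        (j := 1) (by omega) (by omega)
      rwa [one_smul] at this
    · rw [h, zero_smul, add_zero] at hk
      exact absurd hk hne'
    · refine ⟨s₂, (haS s₂ hs₂).1, ?_, rfl⟩
      have := rect_convex (x := s₂) (v := v) (l := k) (haS s₂ hs₂).1 (by
        rw [← hk]; exact (haS s' hs').1) (j := 1) (by omega) (by omega)
      rwa [one_smul] at this
  obtain ⟨y, hy, hyv, hylev⟩ := hexists
  -- `f` and `g` differ on every translate of the level `c` along the level of `z₀`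
  have hcs₁ : c ≤ lev v s₁ := (haS s₁ hs₁).2
  have hdiff : ∀ k : ℤ, ∃ s ∈ rectLevel v n c, f (s + (z₀ - w + k • v)) ≠ g (s + (z₀ - w + k • v)) := by
    intro k
    by_contra! hcon
    obtain ⟨r, hr⟩ := eq_add_smul_of_lev_eq hv (x := w₀) (y := w) (by
      rw [hw.2]
      have := (hw₀ 0).2 (by omega)
      rw [zero_smul, add_zero] at this
      exact this.2)
    have := eq_zero_of_recurrence (lineCoeff_ne_zero hv hs₁) (ζ := fun j => e (z₀ + j • v)) hM₁
      (fun j => by rw [add_smul, ← add_assoc, heper])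
      (fun j => heann.lineCoeff_sum hv hbd rfl (fun z h1 _ => he0 z h1) rfl j) (l := m + 1)
      ?_ (k₀ := r + k) ?_ 0
    · simp only [zero_smul, add_zero] at this
      exact hez₀ this
    · intro i hi j hj
      exact sub_le_of_mem_rectLevel hv hm1 hw hw₀
        (haS _ (by simpa [lineCoeff_apply] using hi)).1
        (haS _ (by simpa [lineCoeff_apply] using hj)).1
    · intro i hi
      have h1 := hcon _ ((hw₀ i).2 ⟨by omega, by exact_mod_cast hi⟩)
      rw [hr, show w + r • v + (i : ℤ) • v + (z₀ - w + k • v) = z₀ + (r + k + i) • v by module] at h1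
      simp only [he, h1, sub_self]
  -- periodicity on the levels met by the annihilator
  set F := shift (z₀ - w) f with hF
  set G := shift (z₀ - w) g with hG
  have hFX : F ∈ orbitClosure η := shift_mem_orbitClosure hf _
  have hwords := ncard_wordsAt_add_complexity_le hFX
    (shift_mem_orbitClosure hg (z₀ - w) : G ∈ orbitClosure η) (T := line v) hSfin hsub
    (by
      rintro _ ⟨k, rfl⟩ s hs
      refine hag _ ?_
      have h1 := hs.2; have h2 := hw.2
      simp only [lev_add, lev_sub, lev_smul, lev_self]
      omega)
    (by
      rintro _ ⟨k, rfl⟩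
      obtain ⟨s, hs, hsne⟩ := hdiff k
      refine ⟨s, ⟨hs.1, hs.2.ge⟩, ?_⟩
      simpa only [hF, hG, shift, add_assoc, add_comm (k • v)] using hsne)
  have hlevels : ∀ i : Set.Ioc c (lev v s₂), ∃ q, lev v q = i ∧
      ∀ j : ℕ, j < m → q + (j : ℤ) • v ∈ rect n 3 := by
    rintro ⟨i, hi1, hi2⟩
    have h0 := (hw₀ 0).2 (by omega)
    rw [zero_smul, add_zero] at h0
    refine exists_consecutive_rect hm1 hv h0.1 ((hw₀ m).2 ⟨by omega, by push_cast; omega⟩).1 hy hyv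
      (by rw [h0.2]; exact hi1) (by rw [hylev]; exact hi2)
  choose q hq hqm using hlevels
  have hfinI : Finite (Set.Ioc c (lev v s₂)) := (Set.finite_Ioc _ _).to_subtype
  obtain ⟨⟨p, hp1, hpm, hp⟩, -⟩ := exists_period_on_lines F v (rectAbove_finite v n (c + 1)) hm1
    (by omega) q (fun i j hj => ⟨hqm i j hj, by
      simp only [lev_add, lev_smul, lev_self, hq]
      have := i.2.1; omega⟩)
  have hFper : ∀ z, c < lev v z → lev v z ≤ lev v s₂ → F (z + (p : ℤ) • v) = F z := by
    intro z h1 h2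
    obtain ⟨k, hk⟩ := eq_add_smul_of_lev_eq hv (x := z) (y := q ⟨lev v z, h1, h2⟩) (by rw [hq])
    have := hp ⟨lev v z, h1, h2⟩ k
    rw [add_smul, ← add_assoc, ← hk] at this
    exact this
  have hFall := H₂ (M₂ * p) (dvd_mul_right _ _) (ι ∘ F) (fun z => ⟨_, rfl⟩) κ (hκ F hFX)
    (lev v s₁) (fun z h1 h2 => by
      have := periodic_mul (x := fun k : ℤ => F (z + k • v)) (p := p) (fun k => by
        rw [add_smul, ← add_assoc]
        exact hFper _ (by simp only [lev_add, lev_smul, lev_self]; omega)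
          (by simp only [lev_add, lev_smul, lev_self]; omega)) M₂ 0
      simp only [zero_add, zero_smul, add_zero] at this
      simp only [Function.comp]
      rw [← this]
      push_cast
      rfl)
  refine ⟨M₂ * p, Nat.mul_pos hM₂ hp1, fun z => ?_⟩
  have := hι (hFall (z - (z₀ - w)))
  simp only [hF, shift] at this
  rw [sub_add_cancel] at this
  rw [← this]
  congr 1
  abel

end

section Strips

variable {A : Type*} [TopologicalSpace A] {η f g : ℤ × ℤ → A}

/-- The coloring of the strip `lo < lev v z ≤ hi` by `F` has a unique extension to the level `lo`. -/
def UniqueBelow (η : ℤ × ℤ → A) (v : ℤ × ℤ) (lo hi : ℤ)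
    (F : ℤ × ℤ → A) : Prop :=
  ∀ β ∈ orbitClosure η, (∀ z, lo < lev v z → lev v z ≤ hi → F z = β z) →
    ∀ z, lev v z = lo → F z = β z

/-- The properties of a balanced set that matter for the colorings of strips: `S` consists of a set
`S'` above the level of `a` and of the points `a + j • v` with `0 ≤ j ≤ m`. -/
structure IsStripSet (η : ℤ × ℤ → A) (v : ℤ × ℤ)
    (S S' : Set (ℤ × ℤ)) (a : ℤ × ℤ) (m : ℕ) (hi : ℤ) : Prop where
  finite : S.Finite
  subset : S' ⊆ S
  pos : 1 ≤ m
  mem_iff : ∀ z, z ∈ S ↔ z ∈ S' ∨ ∃ j : ℤ, 0 ≤ j ∧ j ≤ m ∧ z = a + j • v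
  lev_mem : ∀ z ∈ S', lev v a < lev v z ∧ lev v z ≤ hi
  exists_mem : ∀ i, lev v a < i → i ≤ hi → ∃ q, lev v q = i ∧ ∀ j : ℕ, j < m → q + (j : ℤ) • v ∈ S'
  generated_left : IsGenerated η S a
  generated_right : IsGenerated η S (a + (m : ℤ) • v)
  complexity_le : complexity η S ≤ complexity η S' + m

variable {v : ℤ × ℤ} {S S' : Set (ℤ × ℤ)} {a : ℤ × ℤ} {m : ℕ} {hi : ℤ}

/-- If two points of the orbit closure agree on a strip and on one translate of the edge below,
then they agree on the whole line. -/
theorem IsStripSet.agree_below [DiscreteTopology A] (hS : IsStripSet η v S S' a m hi)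
    (hf : f ∈ orbitClosure η) (hg : g ∈ orbitClosure η)
    (hag : ∀ z, lev v a < lev v z → lev v z ≤ hi → f z = g z) {k₀ : ℤ}
    (hk₀ : ∀ s ∈ S, f (s + k₀ • v) = g (s + k₀ • v)) (k : ℤ) :
    ∀ s ∈ S, f (s + k • v) = g (s + k • v) := by
  have hstrip : ∀ s ∈ S', ∀ k : ℤ, f (s + k • v) = g (s + k • v) := fun s hs k => by
    have := hS.lev_mem s hs
    exact hag _ (by simp only [lev_add, lev_smul, lev_self]; omega)
      (by simp only [lev_add, lev_smul, lev_self]; omega)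
  have hall : ∀ (x : ℤ × ℤ) (k : ℤ), f (x + k • v) = g (x + k • v) →
      Set.EqOn (shift (k • v) f) (shift (k • v) g) (S \ {x}) → ∀ s ∈ S,
        f (s + k • v) = g (s + k • v) := fun x k hx h s hs => by
    by_cases hsx : s = x
    · rw [hsx, hx]
    · exact h ⟨hs, hsx⟩
  induction k using Int.inductionOn' (b := k₀) with
  | zero => exact hk₀
  | succ k _ ih =>
    have h : Set.EqOn (shift ((k + 1) • v) f) (shift ((k + 1) • v) g)
        (S \ {a + (m : ℤ) • v}) := by
      rintro s ⟨hs, hne⟩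
      rcases (hS.mem_iff s).1 hs with h | ⟨j, h0, hjm, rfl⟩
      · exact hstrip s h _
      · have hj : j ≠ m := fun h => hne (by rw [h]; rfl)
        have := ih _ ((hS.mem_iff _).2 (Or.inr ⟨j + 1, by omega, by omega, rfl⟩))
        simp only [shift]
        rwa [show a + j • v + (k + 1) • v = a + (j + 1) • v + k • v by module]
    exact hall _ _ (hS.generated_right.eq_of_eqOn hS.finite
      (shift_mem_orbitClosure hf _) (shift_mem_orbitClosure hg _) h) h
  | pred k _ ih =>
    have h : Set.EqOn (shift ((k - 1) • v) f) (shift ((k - 1) • v) g) (S \ {a}) := by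
      rintro s ⟨hs, hne⟩
      rcases (hS.mem_iff s).1 hs with h | ⟨j, h0, hjm, rfl⟩
      · exact hstrip s h _
      · have hj : j ≠ 0 := fun h => hne (by rw [h, zero_smul, add_zero]; rfl)
        have := ih _ ((hS.mem_iff _).2 (Or.inr ⟨j - 1, by omega, by omega, rfl⟩))
        simp only [shift]
        rwa [show a + j • v + (k - 1) • v = a + (j - 1) • v + k • v by module]
    exact hall _ _ (hS.generated_left.eq_of_eqOn hS.finite
      (shift_mem_orbitClosure hf _) (shift_mem_orbitClosure hg _) h) h

/-- A coloring of a strip that does not extend uniquely has a small period, and so has its extension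
to the next line. -/
theorem IsStripSet.period_of_not_unique [Finite A] [DiscreteTopology A]
    (hS : IsStripSet η v S S' a m hi)
    (hv : IsCoprime v.1 v.2) (hf : f ∈ orbitClosure η)
    (hun : ¬ UniqueBelow η v (lev v a) hi f) :
    (∃ p : ℕ, 1 ≤ p ∧ p ≤ m ∧ ∀ z, lev v a < lev v z → lev v z ≤ hi → f (z + (p : ℤ) • v) = f z) ∧
    ∃ p : ℕ, 1 ≤ p ∧ p ≤ 2 * m ∧
      ∀ z, lev v a ≤ lev v z → lev v z ≤ hi → f (z + (p : ℤ) • v) = f z := by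
  have := hS.finite.to_subtype
  simp only [UniqueBelow, not_forall] at hun
  obtain ⟨g, hg, hag, z₁, hz₁, hne⟩ := hun
  have hw := ncard_wordsAt_add_complexity_le hf hg (T := line v) hS.finite hS.subset
    (by
      rintro _ ⟨k, rfl⟩ s hs
      have := hS.lev_mem s hs
      exact hag _ (by simp only [lev_add, lev_smul, lev_self]; omega)
        (by simp only [lev_add, lev_smul, lev_self]; omega))
    (by
      rintro _ ⟨k, rfl⟩
      by_contra! hcon
      obtain ⟨r, rfl⟩ := eq_add_smul_of_lev_eq hv hz₁
      exact hne (hS.agree_below hf hg hag hcon r a hS.generated_left.1))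
  have hw2 := ncard_wordsAt_le hf hS.finite hS.subset (line v)
  have hle := hS.complexity_le
  have hex : ∀ i : Set.Ioc (lev v a) hi, ∃ q, lev v q = i ∧
      ∀ j : ℕ, j < m → q + (j : ℤ) • v ∈ S' := fun i => hS.exists_mem i i.2.1 i.2.2
  choose q hq hqm using hex
  have hfinI : Finite (Set.Ioc (lev v a) hi) := (Set.finite_Ioc _ _).to_subtype
  have hline : ∀ z (h1 : lev v a < lev v z) (h2 : lev v z ≤ hi),
      ∃ r : ℤ, z = q ⟨lev v z, h1, h2⟩ + r • v := fun z h1 h2 =>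
    eq_add_smul_of_lev_eq hv (by rw [hq])
  obtain ⟨⟨p, hp1, hpm, hp⟩, hdet⟩ := exists_period_on_lines f v (hS.finite.subset hS.subset)
    hS.pos (by omega) q hqm
  refine ⟨⟨p, hp1, hpm, fun z h1 h2 => ?_⟩, ?_⟩
  · obtain ⟨r, hr⟩ := hline z h1 h2
    have := hp ⟨lev v z, h1, h2⟩ r
    rw [add_smul, ← add_assoc, ← hr] at this
    exact this
  set x : ℤ → S → A := fun k => S.domRestrict (shift (k • v) f) with hx
  have hxdet : Deterministic x := by
    intro j k hjk
    have hval : ∀ s ∈ S, f (s + j • v) = f (s + k • v) := fun s hs => congrFun hjk ⟨s, hs⟩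
    have hd := hdet j k (funext fun s => hval s (hS.subset s.2))
    have h : Set.EqOn (shift ((j + 1) • v) f) (shift ((k + 1) • v) f)
        (S \ {a + (m : ℤ) • v}) := by
      rintro s ⟨hs, hne⟩
      simp only [shift]
      rcases (hS.mem_iff s).1 hs with h | ⟨i, h0, him, rfl⟩
      · obtain ⟨h1, h2⟩ := hS.lev_mem s h
        obtain ⟨r, hr⟩ := hline s h1 h2
        have := hd ⟨lev v s, h1, h2⟩ (r + 1)
        rw [show q ⟨lev v s, h1, h2⟩ + (j + (r + 1)) • v =
            q ⟨lev v s, h1, h2⟩ + r • v + (j + 1) • v by module,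
          show q ⟨lev v s, h1, h2⟩ + (k + (r + 1)) • v =
            q ⟨lev v s, h1, h2⟩ + r • v + (k + 1) • v by module, ← hr] at this
        exact this
      · have hi : i ≠ m := fun h => hne (by rw [h]; rfl)
        have := hval _ ((hS.mem_iff _).2 (Or.inr ⟨i + 1, by omega, by omega, rfl⟩))
        rwa [show a + i • v + (j + 1) • v = a + (i + 1) • v + j • v by module,
          show a + i • v + (k + 1) • v = a + (i + 1) • v + k • v by module]
    have hb := hS.generated_right.eq_of_eqOn hS.finite
      (shift_mem_orbitClosure hf _) (shift_mem_orbitClosure hf _) h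
    funext ⟨s, hs⟩
    by_cases hsb : s = a + (m : ℤ) • v
    · subst hsb; exact hb
    · exact h ⟨hs, hsb⟩
  have hrange : Set.range x = wordsAt f S (line v) := by
    rw [wordsAt, line, ← Set.range_comp]; rfl
  obtain ⟨P, hP1, hPm, hP⟩ := hxdet.exists_period (Set.toFinite _) (N := 2 * m) (by
    rw [hrange]; omega)
  have hPS : ∀ s ∈ S, ∀ r : ℤ, f (s + r • v + (P : ℤ) • v) = f (s + r • v) := fun s hs r => by
    have : f (s + (r + P) • v) = f (s + r • v) := congrFun (hP r) ⟨s, hs⟩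
    rwa [add_smul, ← add_assoc] at this
  refine ⟨P, hP1, hPm, fun z h1 h2 => ?_⟩
  rcases eq_or_lt_of_le h1 with h1 | h1
  · obtain ⟨r, rfl⟩ := eq_add_smul_of_lev_eq hv h1.symm
    exact hPS a hS.generated_left.1 r
  · obtain ⟨r, hr⟩ := hline z h1 h2
    rw [hr]
    have := hqm ⟨lev v z, h1, h2⟩ 0 hS.pos
    rw [Nat.cast_zero, zero_smul, add_zero] at this
    exact hPS _ (hS.subset this) r

theorem UniqueBelow.congr {lo hi : ℤ} {F F' : ℤ × ℤ → A} (h : UniqueBelow η v lo hi F)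
    (hF' : F' ∈ orbitClosure η) (heq : ∀ z, lo < lev v z → lev v z ≤ hi → F z = F' z) :
    UniqueBelow η v lo hi F' := fun β hβ hag z hz => by
  rw [← h F' hF' heq z hz]
  exact h β hβ (fun z h1 h2 => (heq z h1 h2).trans (hag z h1 h2)) z hz

/-- For a periodic point, strips that do not extend uniquely downwards are found above every strip
if there is one at all. -/
theorem exists_not_unique_above [Finite A] {e : ℤ × ℤ} (hv : IsCoprime v.1 v.2) (he : lev v e = 1)
    {lo hi : ℤ} (hf : f ∈ orbitClosure η) {M : ℕ} (hM : 1 ≤ M)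
    (hper : ∀ z, f (z + (M : ℤ) • v) = f z) {t₁ : ℤ}
    (ht₁ : ¬ UniqueBelow η v lo hi (shift (t₁ • e) f)) (T : ℤ) :
    ∃ t, T ≤ t ∧ ¬ UniqueBelow η v lo hi (shift (t • e) f) := by
  by_contra! hcon
  obtain ⟨t, ht, hmax⟩ := Int.exists_greatest_of_bdd
    (P := fun t => ¬ UniqueBelow η v lo hi (shift (t • e) f))
    ⟨T, fun t ht => by by_contra! h; exact ht (hcon t h.le)⟩ ⟨t₁, ht₁⟩
  have huniq : ∀ s, t < s → UniqueBelow η v lo hi (shift (s • e) f) := fun s hs => by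
    by_contra h
    have := hmax s h
    omega
  have hfinI : Finite (Set.Ioc lo hi) := (Set.finite_Ioc _ _).to_subtype
  set σ : Set.Ioi t → (Set.Ioc lo hi × Fin M → A) := fun s i =>
    shift ((s : ℤ) • e) f ((i.1 : ℤ) • e + ((i.2 : ℕ) : ℤ) • v) with hσ
  have : Infinite (Set.Ioi t) := (Set.Ioi_infinite t).to_subtype
  obtain ⟨s, s', hne, hss⟩ := Finite.exists_ne_map_eq_of_infinite σ
  wlog hlt : (s : ℤ) < s' generalizing s s'
  · exact this s' s hne.symm hss.symm (lt_of_le_of_ne (not_lt.1 hlt) fun h => hne (Subtype.ext h.symm))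
  obtain ⟨s, hs⟩ := s
  obtain ⟨s', hs'⟩ := s'
  simp only [Set.mem_Ioi] at hs hs' hlt
  have h0 : ∀ z, lo < lev v z → lev v z ≤ hi → shift (s' • e) f z = shift (s • e) f z := by
    intro z h1 h2
    obtain ⟨r, hr⟩ := eq_add_smul_of_lev_eq hv (x := z) (y := lev v z • e) (by
      rw [lev_smul, he, mul_one])
    have hmod : ∀ y : ℤ × ℤ, f (y + r • v) = f (y + (((r % M).toNat : ℕ) : ℤ) • v) := fun y => by
      have := periodic_mul (x := fun k : ℤ => f (y + k • v)) (p := M) (fun k => by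
        rw [add_smul, ← add_assoc, hper]) (r / M) (r % M)
      rw [mul_comm, Int.emod_add_mul_ediv] at this
      rw [this, Int.toNat_of_nonneg (Int.emod_nonneg _ (by omega))]
    have hlt' : (r % M).toNat < M := by
      have := Int.emod_lt_of_pos r (show (0 : ℤ) < M by omega)
      have := Int.emod_nonneg r (show (M : ℤ) ≠ 0 by omega)
      omega
    have h3 := congrFun hss (⟨lev v z, h1, h2⟩, ⟨(r % M).toNat, hlt'⟩)
    simp only [hσ, shift] at h3 ⊢
    have hmod' : ∀ y : ℤ × ℤ, f (lev v z • e + r • v + y) =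
        f (lev v z • e + (((r % M).toNat : ℕ) : ℤ) • v + y) := fun y => by
      rw [add_right_comm, hmod, add_right_comm]
    rw [hr, hmod', hmod', h3]
  have hstep : ∀ n : ℕ, t ≤ s - n → ∀ z, lo < lev v z → lev v z ≤ hi →
      shift ((s' - n) • e) f z = shift ((s - n) • e) f z := by
    intro n
    induction n with
    | zero => intro _; simpa using h0
    | succ n ih =>
      intro hn z h1 h2
      push_cast at hn ⊢
      have ih' := ih (by omega)
      have hz : ∀ y, lo ≤ lev v y → lev v y ≤ hi →
          shift ((s' - n) • e) f y = shift ((s - n) • e) f y := by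
        intro y hy1 hy2
        rcases eq_or_lt_of_le hy1 with h | h
        · exact huniq (s' - n) (by omega) _ (shift_mem_orbitClosure hf _) ih' y h.symm
        · exact ih' y h hy2
      have := hz (z - e) (by rw [lev_sub, he]; omega) (by rw [lev_sub, he]; omega)
      simp only [shift] at this ⊢
      rw [show z + (s' - ((n : ℤ) + 1)) • e = z - e + (s' - n) • e by module,
        show z + (s - ((n : ℤ) + 1)) • e = z - e + (s - n) • e by module, this]
  obtain ⟨n, hn⟩ := Int.eq_ofNat_of_zero_le (sub_nonneg.2 hs.le)
  have h1 := hstep n (by omega)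
  rw [show s - (n : ℤ) = t by omega] at h1
  exact ht ((huniq (s' - n) (by omega)).congr (shift_mem_orbitClosure hf _) h1)

/-- If some strip of a periodic point does not extend uniquely downwards, then all strips have
period at most `2 * m`. -/
theorem IsStripSet.period_le [Finite A] [DiscreteTopology A]
    (hS : IsStripSet η v S S' a m hi) (hv : IsCoprime v.1 v.2)
    (hf : f ∈ orbitClosure η) {e : ℤ × ℤ} (he : lev v e = 1) {M : ℕ} (hM : 1 ≤ M)
    (hper : ∀ z, f (z + (M : ℤ) • v) = f z) {t₁ : ℤ}
    (ht₁ : ¬ UniqueBelow η v (lev v a) hi (shift (t₁ • e) f)) :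
    ∃ p : ℕ, 1 ≤ p ∧ p ≤ 2 * m ∧
      ∀ z, lev v a < lev v z → lev v z ≤ hi → f (z + (p : ℤ) • v) = f z := by
  obtain ⟨t, ht, hun⟩ := exists_not_unique_above hv he hf hM hper ht₁ 0
  have key : ∀ n : ℕ, ∃ p : ℕ, 1 ≤ p ∧ p ≤ 2 * m ∧ ∀ z, lev v a < lev v z → lev v z ≤ hi →
      shift ((t - n) • e) f (z + (p : ℤ) • v) = shift ((t - n) • e) f z := by
    intro n
    induction n with
    | zero =>
      obtain ⟨p, h1, h2, h3⟩ := (hS.period_of_not_unique hv (shift_mem_orbitClosure hf _) hun).2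
      refine ⟨p, h1, h2, fun z hz => ?_⟩
      simpa using h3 z hz.le
    | succ n ih =>
      obtain ⟨p, h1, h2, h3⟩ : ∃ p : ℕ, 1 ≤ p ∧ p ≤ 2 * m ∧ ∀ z, lev v a ≤ lev v z →
          lev v z ≤ hi → shift ((t - n) • e) f (z + (p : ℤ) • v) = shift ((t - n) • e) f z := by
        by_cases hu : UniqueBelow η v (lev v a) hi (shift ((t - n) • e) f)
        · obtain ⟨p, h1, h2, h3⟩ := ih
          refine ⟨p, h1, h2, fun z hz hz' => ?_⟩
          rcases eq_or_lt_of_le hz with h | h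
          · exact (hu (shift ((p : ℤ) • v) (shift ((t - n) • e) f))
              (shift_mem_orbitClosure (shift_mem_orbitClosure hf _) _)
              (fun z hz hz' => (h3 z hz hz').symm) z h.symm).symm
          · exact h3 z h hz'
        · exact (hS.period_of_not_unique hv (shift_mem_orbitClosure hf _) hu).2
      refine ⟨p, h1, h2, fun z hz hz' => ?_⟩
      have := h3 (z - e) (by rw [lev_sub, he]; omega) (by rw [lev_sub, he]; omega)
      simp only [shift] at this ⊢
      push_cast
      rw [show z + (p : ℤ) • v + (t - ((n : ℤ) + 1)) • e = z - e + (p : ℤ) • v + (t - n) • e by module,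
        show z + (t - ((n : ℤ) + 1)) • e = z - e + (t - n) • e by module, this]
  obtain ⟨n, rfl⟩ := Int.eq_ofNat_of_zero_le ht
  obtain ⟨p, h1, h2, h3⟩ := key n
  refine ⟨p, h1, h2, fun z hz hz' => ?_⟩
  simpa [shift] using h3 z hz hz'

end Strips

section Geometry

theorem cross_smul_toPlane (κ : ℝ) (v z : ℤ × ℤ) :
    cross (κ • toPlane v) (toPlane z) = κ * lev v z := by
  simp only [cross, toPlane, lev, Prod.smul_fst, Prod.smul_snd, smul_eq_mul]
  push_cast; ring

theorem cross_toPlane (v z : ℤ × ℤ) : cross (toPlane v) (toPlane z) = lev v z := by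
  simpa using cross_smul_toPlane 1 v z

theorem toPlane_injective : Function.Injective toPlane := fun x y h => by
  simp only [toPlane, Prod.mk.injEq, Int.cast_inj] at h
  exact Prod.ext h.1 h.2

theorem toPlane_add_smul (x v : ℤ × ℤ) (k : ℤ) :
    toPlane (x + k • v) = toPlane x + (k : ℝ) • toPlane v := by
  simp [toPlane]

theorem toPlane_ne_zero {v : ℤ × ℤ} (hv : v ≠ 0) : toPlane v ≠ 0 := fun h =>
  hv (toPlane_injective (h.trans (by simp [toPlane]; rfl)))

/-- A direction with an integer vector of level zero is a positive multiple of a primitive integer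
vector. -/
theorem exists_eq_smul_toPlane {d : ℝ × ℝ} (hd : d ≠ 0) {z : ℤ × ℤ} (hz : z ≠ 0)
    (hcross : cross d (toPlane z) = 0) :
    ∃ v : ℤ × ℤ, IsCoprime v.1 v.2 ∧ ∃ κ : ℝ, 0 < κ ∧ d = κ • toPlane v := by
  have hg : 0 < Int.gcd z.1 z.2 := Int.gcd_pos_iff.2 (by
    by_contra! h
    exact hz (Prod.ext h.1 h.2))
  obtain ⟨x, y, hxy, h1, h2⟩ := Int.exists_gcd_one hg
  set γ := Int.gcd z.1 z.2
  have hγ : (γ : ℝ) ≠ 0 := by exact_mod_cast hg.ne'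
  have hcop : IsCoprime x y := Int.isCoprime_iff_gcd_eq_one.2 hxy
  have hc : d.1 * y - d.2 * x = 0 := by
    simp only [cross, toPlane, h1, h2] at hcross
    push_cast at hcross
    have : (d.1 * y - d.2 * x) * γ = 0 := by linear_combination hcross
    exact (mul_eq_zero.1 this).resolve_right hγ
  have hpos : (0 : ℝ) < x ^ 2 + y ^ 2 := by
    rcases eq_or_ne x 0 with h | h
    · have : y ≠ 0 := by
        rintro rfl
        rw [h] at hcop
        exact not_isUnit_zero (isCoprime_zero_left.1 hcop)
      have : (y : ℝ) ≠ 0 := by exact_mod_cast this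
      positivity
    · have : (x : ℝ) ≠ 0 := by exact_mod_cast h
      positivity
  set τ := (d.1 * x + d.2 * y) / (x ^ 2 + y ^ 2) with hτ
  have e1 : d.1 = τ * x := by
    rw [hτ]; field_simp; linear_combination (y : ℝ) * hc
  have e2 : d.2 = τ * y := by
    rw [hτ]; field_simp; linear_combination (-(x : ℝ)) * hc
  have hτ0 : τ ≠ 0 := fun h => hd (Prod.ext (by rw [e1, h, zero_mul]; rfl) (by rw [e2, h, zero_mul]; rfl))
  rcases lt_or_gt_of_ne hτ0 with h | h
  · refine ⟨(-x, -y), hcop.neg_neg, -τ, by linarith, Prod.ext ?_ ?_⟩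
    · simp [toPlane, e1]
    · simp [toPlane, e2]
  · exact ⟨(x, y), hcop, τ, h, Prod.ext (by simp [toPlane, e1]) (by simp [toPlane, e2])⟩

/-- A nonexpansive direction is rational. -/
theorem exists_primitive_direction {A : Type*} [Finite A] [TopologicalSpace A]
    [DiscreteTopology A] {η f g : ℤ × ℤ → A} {S : Set (ℤ × ℤ)} (hS : S.Finite)
    (hη : complexity η S ≤ S.ncard) {d : ℝ × ℝ} (hd : d ≠ 0) {c : ℝ}
    (hf : f ∈ orbitClosure η) (hg : g ∈ orbitClosure η) (hfg : f ≠ g)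
    (hH : AgreeOn f g (halfPlane d c)) :
    ∃ v : ℤ × ℤ, IsCoprime v.1 v.2 ∧ ∃ κ : ℝ, 0 < κ ∧ d = κ • toPlane v := by
  obtain ⟨ι, hι⟩ := exists_injective_complex A
  obtain ⟨a, ha0, -, κ, hκ⟩ := exists_annihilates ι hS hη
  obtain ⟨s₀, hs₀, hmin⟩ := Finset.exists_min_image a.support (fun s => cross d (toPlane s))
    (Finsupp.support_nonempty_iff.2 ha0)
  have hadd : ∀ x y : ℤ × ℤ, cross d (toPlane (x + y)) = cross d (toPlane x) + cross d (toPlane y) :=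
    fun x y => by simp only [cross, toPlane, Prod.fst_add, Prod.snd_add]; push_cast; ring
  have hsub : ∀ x y : ℤ × ℤ, cross d (toPlane (x - y)) = cross d (toPlane x) - cross d (toPlane y) :=
    fun x y => by simp only [cross, toPlane, Prod.fst_sub, Prod.snd_sub]; push_cast; ring
  by_cases hex : ∃ s ∈ a.support, s ≠ s₀ ∧ cross d (toPlane s) = cross d (toPlane s₀)
  · obtain ⟨s, -, hne, heq⟩ := hex
    exact exists_eq_smul_toPlane hd (sub_ne_zero.2 hne) (by rw [hsub, heq, sub_self])
  exfalso
  push Not at hex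
  obtain ⟨δ, hδ, hgap⟩ : ∃ δ > 0, ∀ s ∈ a.support, s ≠ s₀ →
      cross d (toPlane s₀) + δ ≤ cross d (toPlane s) := by
    rcases (a.support.erase s₀).eq_empty_or_nonempty with h | h
    · refine ⟨1, one_pos, fun s hs hne => ?_⟩
      have := Finset.mem_erase.2 ⟨hne, hs⟩
      simp [h] at this
    · obtain ⟨s₁, hs₁, hmin'⟩ := Finset.exists_min_image _ (fun s => cross d (toPlane s)) h
      obtain ⟨hne, hs₁⟩ := Finset.mem_erase.1 hs₁
      refine ⟨cross d (toPlane s₁) - cross d (toPlane s₀),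
        sub_pos.2 (lt_of_le_of_ne (hmin s₁ hs₁) (hex s₁ hs₁ hne).symm), fun s hs hne' => ?_⟩
      have := hmin' s (Finset.mem_erase.2 ⟨hne', hs⟩)
      linarith
  have hann : Annihilates a 0 fun z => ι (f z) - ι (g z) := by
    have := (hκ f hf).sub (hκ g hg)
    rwa [sub_self] at this
  have key : ∀ n : ℕ, ∀ z, c - n * δ ≤ cross d (toPlane z) → f z = g z := by
    intro n
    induction n with
    | zero => intro z hz; exact hH z (by simpa [halfPlane] using hz)
    | succ n ih =>
      intro z hz
      have h1 := hann (z - s₀)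
      rw [Finsupp.sum, Finset.sum_eq_single_of_mem s₀ hs₀] at h1
      · rw [add_sub_cancel] at h1
        exact hι (sub_eq_zero.1 ((mul_eq_zero.1 h1).resolve_left (Finsupp.mem_support_iff.1 hs₀)))
      · intro s hs hne
        have h2 := hgap s hs hne
        have h3 := ih (s + (z - s₀)) (by rw [hadd, hsub]; push_cast at hz; linarith)
        simp only [h3, sub_self, mul_zero]
  apply hfg
  funext z
  obtain ⟨n, hn⟩ := exists_nat_ge ((c - cross d (toPlane z)) / δ)
  exact key n z (by rw [div_le_iff₀ hδ] at hn; linarith)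

variable {S : Set (ℤ × ℤ)} {a b v : ℤ × ℤ} {d : ℝ × ℝ} {κ : ℝ}

theorem toPlane_mem_hull {z : ℤ × ℤ} (hz : z ∈ S) : toPlane z ∈ hull S :=
  subset_convexHull ℝ _ ⟨z, hz, rfl⟩

theorem IsLatticeConvex.mem_of_hull (hS : IsLatticeConvex S) {z : ℤ × ℤ}
    (hz : toPlane z ∈ hull S) : z ∈ S := by
  rw [hS]; exact hz

theorem IsLatticeConvex.add_smul_mem (hS : IsLatticeConvex S) {x : ℤ × ℤ} (hx : x ∈ S) {j l : ℤ}
    (hl : x + l • v ∈ S) (h0 : 0 ≤ j) (hjl : j ≤ l) : x + j • v ∈ S := by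
  rcases eq_or_lt_of_le (h0.trans hjl) with h | h
  · obtain rfl : j = 0 := by omega
    simpa using hx
  apply hS.mem_of_hull
  have h' : (0 : ℝ) < l := by exact_mod_cast h
  have := (convex_convexHull ℝ (toPlane '' S)).add_smul_sub_mem (toPlane_mem_hull hx)
    (toPlane_mem_hull hl) (t := (j : ℝ) / l)
    ⟨div_nonneg (by exact_mod_cast h0) h'.le, (div_le_one h').2 (by exact_mod_cast hjl)⟩
  rwa [toPlane_add_smul, add_sub_cancel_left, smul_smul, div_mul_cancel₀ _ h'.ne',
    ← toPlane_add_smul] at this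

theorem PointsAlong.exists_eq_smul (hv : IsCoprime v.1 v.2) (hκ : 0 < κ)
    {w : ℤ × ℤ} (h : PointsAlong (κ • toPlane v) w) : ∃ m : ℕ, 1 ≤ m ∧ w = (m : ℤ) • v := by
  obtain ⟨t, ht, hw⟩ := h
  rw [smul_smul] at hw
  have h0 : lev v w = 0 := by
    have := cross_toPlane v w
    rw [hw] at this
    have h2 : cross (toPlane v) ((t * κ) • toPlane v) = 0 := by
      simp only [cross, Prod.smul_fst, Prod.smul_snd, smul_eq_mul]; ring
    rw [h2] at this
    exact_mod_cast this.symm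
  obtain ⟨k, rfl⟩ := eq_smul_of_lev_eq_zero hv h0
  have h1 : toPlane (k • v) = (k : ℝ) • toPlane v := by
    have := toPlane_add_smul 0 v k
    rw [zero_add] at this
    rw [this]; simp [toPlane]
  rw [h1] at hw
  have h2 : (k : ℝ) = t * κ :=
    smul_left_injective ℝ (toPlane_ne_zero (ne_zero_of_isCoprime hv)) hw
  have h3 : (0 : ℝ) < k := h2 ▸ mul_pos ht hκ
  have h4 : 0 < k := by exact_mod_cast h3
  exact ⟨k.toNat, by omega, by rw [Int.toNat_of_nonneg h4.le]⟩

theorem mem_edgePoints (hv : IsCoprime v.1 v.2) {m : ℕ} (hm : 1 ≤ m) {z : ℤ × ℤ} :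
    z ∈ edgePoints a (a + (m : ℤ) • v) ↔ ∃ j : ℤ, 0 ≤ j ∧ j ≤ m ∧ z = a + j • v := by
  have hm' : (0 : ℝ) < m := by exact_mod_cast hm
  rw [edgePoints, Set.mem_ofPred_eq, segment_eq_image', Set.mem_image, toPlane_add_smul,
    add_sub_cancel_left]
  constructor
  · rintro ⟨θ, ⟨h0, h1⟩, h⟩
    have hlev : lev v z = lev v a := by
      have h2 := cross_toPlane v z
      have h3 := cross_toPlane v a
      have h4 : cross (toPlane v) (toPlane z) = cross (toPlane v) (toPlane a) := by
        rw [← h]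
        simp only [cross, Prod.smul_fst, Prod.smul_snd, Prod.fst_add, Prod.snd_add, smul_eq_mul]
        ring
      rw [h2, h3] at h4
      exact_mod_cast h4
    obtain ⟨j, rfl⟩ := eq_add_smul_of_lev_eq hv hlev
    rw [toPlane_add_smul, smul_smul] at h
    have h5 := smul_left_injective ℝ (toPlane_ne_zero (ne_zero_of_isCoprime hv))
      (add_left_cancel h)
    simp only [Int.cast_natCast] at h5
    refine ⟨j, ?_, ?_, rfl⟩
    · have : (0 : ℝ) ≤ j := h5 ▸ mul_nonneg h0 hm'.le
      exact_mod_cast this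
    · have : (j : ℝ) ≤ m := h5 ▸ mul_le_of_le_one_left hm'.le h1
      exact_mod_cast this
  · rintro ⟨j, h0, h1, rfl⟩
    refine ⟨j / m, ⟨div_nonneg (by exact_mod_cast h0) hm'.le,
      (div_le_one hm').2 (by exact_mod_cast h1)⟩, ?_⟩
    rw [toPlane_add_smul, smul_smul, Int.cast_natCast, div_mul_cancel₀ _ hm'.ne']

theorem ncard_edgePoints (hv : IsCoprime v.1 v.2) {m : ℕ} (hm : 1 ≤ m) :
    (edgePoints a (a + (m : ℤ) • v)).ncard = m + 1 := by
  have : edgePoints a (a + (m : ℤ) • v) = (fun j : ℤ => a + j • v) '' Set.Icc 0 (m : ℤ) := by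
    ext z
    rw [mem_edgePoints hv hm]
    simp only [Set.mem_image, Set.mem_Icc, and_assoc, eq_comm]
  rw [this, Set.ncard_image_of_injective _ (add_smul_injective hv a), ← Finset.coe_Icc,
    Set.ncard_coe_finset, Int.card_Icc]
  omega

theorem IsEdge.cross_eq {m : ℕ} (x : ℝ × ℝ) :
    cross (toPlane (a + (m : ℤ) • v - a)) (x - toPlane a) =
      m * (cross (toPlane v) x - lev v a) := by
  rw [← cross_toPlane, add_sub_cancel_left]
  simp only [cross, toPlane, Prod.smul_fst, Prod.smul_snd, Prod.fst_sub, Prod.snd_sub, smul_eq_mul]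
  push_cast
  ring

theorem IsEdge.lev_le {m : ℕ} (hm : 1 ≤ m) (h : IsEdge S a (a + (m : ℤ) • v)) {s : ℤ × ℤ}
    (hs : s ∈ S) : lev v a ≤ lev v s := by
  have h1 := h.left _ (toPlane_mem_hull hs)
  rw [IsEdge.cross_eq, cross_toPlane] at h1
  have hm' : (0 : ℝ) < m := by exact_mod_cast hm
  have := nonneg_of_mul_nonneg_right h1 hm'
  have h2 : (lev v a : ℝ) ≤ lev v s := by linarith
  exact_mod_cast h2

theorem IsEdge.mem_edgePoints_iff {m : ℕ} (hm : 1 ≤ m) (h : IsEdge S a (a + (m : ℤ) • v))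
    (hS : IsLatticeConvex S) {z : ℤ × ℤ} :
    z ∈ edgePoints a (a + (m : ℤ) • v) ↔ z ∈ S ∧ lev v z = lev v a := by
  have hm' : (m : ℝ) ≠ 0 := by exact_mod_cast (show m ≠ 0 by omega)
  rw [edgePoints, Set.mem_ofPred_eq, ← h.face, Set.mem_ofPred_eq, IsEdge.cross_eq, cross_toPlane]
  refine ⟨fun ⟨h1, h2⟩ => ⟨hS.mem_of_hull h1, ?_⟩, fun ⟨h1, h2⟩ => ⟨toPlane_mem_hull h1, by
    rw [h2, sub_self, mul_zero]⟩⟩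
  have := sub_eq_zero.1 ((mul_eq_zero.1 h2).resolve_left hm')
  exact_mod_cast this

/-- A polygon of positive area does not lie in a line. -/
theorem exists_lev_ne (hv : v ≠ 0) (h : 0 < MeasureTheory.volume (hull S)) (i : ℤ) :
    ∃ s ∈ S, lev v s ≠ i := by
  by_contra! hcon
  set φ : ℝ × ℝ →ₗ[ℝ] ℝ :=
    { toFun := cross (toPlane v)
      map_add' := fun x y => by simp only [cross, Prod.fst_add, Prod.snd_add]; ring
      map_smul' := fun r x => by
        simp only [cross, Prod.smul_fst, Prod.smul_snd, smul_eq_mul, RingHom.id_apply]; ring }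
    with hφ
  set E : AffineSubspace ℝ (ℝ × ℝ) :=
    (AffineSubspace.mk' (i : ℝ) (⊥ : Submodule ℝ ℝ)).comap φ.toAffineMap with hE
  have hmem : ∀ x, x ∈ E ↔ cross (toPlane v) x = i := fun x => by
    simp [hE, AffineSubspace.mem_comap, AffineSubspace.mem_mk', sub_eq_zero, hφ]
  have hsub : hull S ⊆ E := by
    refine convexHull_min ?_ E.convex
    rintro _ ⟨s, hs, rfl⟩
    exact (hmem _).2 (by rw [cross_toPlane, hcon s hs])
  have hne : E ≠ ⊤ := fun htop => by
    have hv' := toPlane_ne_zero hv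
    have h1 : ∀ x : ℝ × ℝ, cross (toPlane v) x = i := fun x => (hmem x).1 (htop ▸ AffineSubspace.mem_top ℝ _ x)
    have h2 := h1 0
    have h3 := h1 (1, 0)
    have h4 := h1 (0, 1)
    simp only [cross, Prod.fst_zero, Prod.snd_zero, mul_zero, mul_one, sub_zero, zero_sub] at h2 h3 h4
    exact hv' (Prod.ext (by simp; linarith) (by simp; linarith))
  have := MeasureTheory.Measure.addHaar_affineSubspace MeasureTheory.volume E hne
  exact h.ne' (MeasureTheory.measure_mono_null hsub this)

end Geometry

theorem mem_border_iff {v : ℤ × ℤ} {κ : ℝ} (hκ : 0 < κ) {S : Set (ℤ × ℤ)} {z : ℤ × ℤ} :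
    z ∈ border (κ • toPlane v) S ↔ ∃ s ∈ S, ∃ t ∈ S, lev v s ≤ lev v z ∧ lev v z ≤ lev v t := by
  simp only [border, Set.mem_ofPred_eq, cross_smul_toPlane, mul_le_mul_iff_right₀ hκ, Int.cast_le]

section

variable {A : Type*} [TopologicalSpace A] {η : ℤ × ℤ → A} {v : ℤ × ℤ} {κ : ℝ}
  {S : Set (ℤ × ℤ)} {a b : ℤ × ℤ}

/-- A balanced set whose lines cover its border, in terms of integral levels. -/
theorem IsBalanced.exists_isStripSet (hv : IsCoprime v.1 v.2) (hκ : 0 < κ)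
    (hS : IsBalanced η (κ • toPlane v) S) (hmeet : MeetsEveryLine (κ • toPlane v) S)
    (hab : IsEdge S a b) (hpt : PointsAlong (κ • toPlane v) (b - a)) :
    ∃ (m : ℕ) (hi : ℤ), (edgePoints a b).ncard = m + 1 ∧
      IsStripSet η v S (S \ edgePoints a b) a m hi ∧
      (∀ z, z ∈ border (κ • toPlane v) S ↔ lev v a ≤ lev v z ∧ lev v z ≤ hi) ∧
      ∀ z, z ∈ border (κ • toPlane v) (S \ edgePoints a b) ↔ lev v a < lev v z ∧ lev v z ≤ hi := by
  obtain ⟨hfin, hconv, a', b', ⟨hab', hpt'⟩, ⟨hga, hgb⟩, hdisc, hcount⟩ := hS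
  obtain ⟨m, hm, hbm⟩ := hpt.exists_eq_smul hv hκ
  obtain ⟨m', hm', hbm'⟩ := hpt'.exists_eq_smul hv hκ
  obtain rfl := eq_add_of_sub_eq' hbm
  obtain rfl := eq_add_of_sub_eq' hbm'
  have hE := fun z => hab.mem_edgePoints_iff hm hconv (z := z)
  have hE' := fun z => hab'.mem_edgePoints_iff hm' hconv (z := z)
  have hlev : lev v a' = lev v a :=
    le_antisymm (hab'.lev_le hm' ((hE a).1 ((mem_edgePoints hv hm).2 ⟨0, by simp⟩)).1)
      (hab.lev_le hm hga.1)
  have hEE : edgePoints a' (a' + (m' : ℤ) • v) = edgePoints a (a + (m : ℤ) • v) := by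
    ext z; rw [hE, hE', hlev]
  have hmm : m' = m := by
    have h1 := ncard_edgePoints (a := a') hv hm'
    rw [hEE, ncard_edgePoints hv hm] at h1
    omega
  subst hmm
  have haa : a' = a := by
    have h1 : a' ∈ edgePoints a (a + (m' : ℤ) • v) := hEE ▸ (mem_edgePoints hv hm).2 ⟨0, by simp⟩
    have h2 : a ∈ edgePoints a' (a' + (m' : ℤ) • v) := hEE ▸ (mem_edgePoints hv hm).2 ⟨0, by simp⟩
    obtain ⟨j, hj, -, h1⟩ := (mem_edgePoints hv hm).1 h1
    obtain ⟨j', hj', -, h2⟩ := (mem_edgePoints hv hm).1 h2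
    have h3 : a + (0 : ℤ) • v = a + (j + j') • v := by
      rw [zero_smul, add_zero, add_smul, ← add_assoc, ← h1, ← h2]
    have := add_smul_injective hv a h3
    obtain rfl : j = 0 := by omega
    simpa using h1
  subst haa
  set w := edgePoints a' (a' + (m' : ℤ) • v) with hw
  have hwS : w ⊆ S := fun z hz => ((hE z).1 hz).1
  have hwcard : w.ncard = m' + 1 := ncard_edgePoints hv hm
  have hlow : ∀ s ∈ S, lev v a' ≤ lev v s := fun s hs => hab.lev_le hm hs
  have hS' : ∀ z, z ∈ S \ w ↔ z ∈ S ∧ lev v a' < lev v z := fun z => by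
    rw [Set.mem_sdiff, hE]
    refine ⟨fun ⟨h1, h2⟩ => ⟨h1, lt_of_le_of_ne (hlow z h1) fun h => h2 ⟨h1, h.symm⟩⟩,
      fun ⟨h1, h2⟩ => ⟨h1, fun h => h2.ne' h.2⟩⟩
  obtain ⟨t, ht, htmax⟩ := Set.exists_max_image S (lev v) hfin ⟨a', hga.1⟩
  have hborder : ∀ z, z ∈ border (κ • toPlane v) S ↔ lev v a' ≤ lev v z ∧ lev v z ≤ lev v t := by
    intro z
    rw [mem_border_iff hκ]
    exact ⟨fun ⟨s, hs, s', hs', h1, h2⟩ => ⟨(hlow s hs).trans h1, h2.trans (htmax s' hs')⟩,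
      fun ⟨h1, h2⟩ => ⟨a', hga.1, t, ht, h1, h2⟩⟩
  obtain ⟨e, he⟩ := exists_lev_eq_one hv
  have hmeet' : ∀ i, lev v a' ≤ i → i ≤ lev v t → ∃ s ∈ S, lev v s = i := by
    intro i h1 h2
    obtain ⟨s, hs, hsi⟩ := hmeet (i • e) ((hborder _).2 (by rw [lev_smul, he, mul_one]; exact ⟨h1, h2⟩))
    refine ⟨s, hs, ?_⟩
    rw [cross_smul_toPlane, cross_smul_toPlane, lev_smul, he, mul_one] at hsi
    exact_mod_cast mul_left_cancel₀ hκ.ne' hsi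
  have htop : lev v a' < lev v t := by
    obtain ⟨s, hs, hne⟩ := exists_lev_ne (ne_zero_of_isCoprime hv) hab.area_pos (lev v a')
    exact (lt_of_le_of_ne (hlow s hs) hne.symm).trans_le (htmax s hs)
  refine ⟨m', lev v t, hwcard, ⟨hfin, Set.sdiff_subset, hm, fun z => ?_, fun z hz => ?_,
    fun i h1 h2 => ?_, hga, hgb, ?_⟩, hborder, fun z => ?_⟩
  · rw [← mem_edgePoints hv hm, ← hw]
    refine ⟨fun hz => ?_, fun hz => hz.elim (fun h => h.1) fun h => hwS h⟩
    by_cases h : z ∈ w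
    · exact Or.inr h
    · exact Or.inl ⟨hz, h⟩
  · have := (hS' z).1 hz
    exact ⟨this.2, htmax z this.1⟩
  · obtain ⟨s, hs, hsi⟩ := hmeet' i h1.le h2
    have hset : S ∩ {z | cross (κ • toPlane v) (toPlane z) = κ * i} = {z ∈ S | lev v z = i} := by
      ext z
      simp only [Set.mem_inter_iff, Set.mem_ofPred_eq, cross_smul_toPlane,
        mul_right_inj' hκ.ne', Int.cast_inj]
    have hc := hcount (κ * i) (by rw [hset]; exact ⟨s, hs, hsi⟩)
    rw [hset, Set.inter_eq_left.2 hwS, hwcard] at hc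
    obtain ⟨q, hq⟩ := exists_consecutive hv (hfin.subset fun z hz => hz.1 : {z ∈ S | lev v z = i}.Finite)
      ⟨s, hs, hsi⟩ (fun x hx y hy => hx.2.trans hy.2.symm)
      (fun x hx j l hl h0 hjl => ⟨hconv.add_smul_mem hx.1 hl.1 h0 hjl, by
        simp only [lev_add, lev_smul, lev_self, mul_zero, add_zero]; exact hx.2⟩)
    have hmem : ∀ j : ℕ, j < m' → q + (j : ℤ) • v ∈ {z ∈ S | lev v z = i} := fun j hj =>
      (hq j).2 ⟨by omega, by omega⟩
    refine ⟨q, ?_, fun j hj => (hS' _).2 ⟨(hmem j hj).1, ?_⟩⟩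
    · have := (hmem 0 (by omega)).2
      simpa using this
    · rw [(hmem j hj).2]; exact h1
  · simp only [discrepancy] at hdisc
    have := Set.ncard_sdiff_add_ncard_of_subset hwS hfin
    omega
  · rw [mem_border_iff hκ]
    constructor
    · rintro ⟨s, hs, s', hs', h1, h2⟩
      exact ⟨((hS' s).1 hs).2.trans_le h1, h2.trans (htmax s' hs'.1)⟩
    · rintro ⟨h1, h2⟩
      obtain ⟨s, hs, hsz⟩ := hmeet' _ h1.le h2
      exact ⟨s, (hS' s).2 ⟨hs, hsz ▸ h1⟩, t, (hS' t).2 ⟨ht, htop⟩, hsz.le, h2⟩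

end

end Nivat

theorem mainTheorem7 {A : Type*} [Finite A] [TopologicalSpace A] [DiscreteTopology A]
    (η : ℤ × ℤ → A)
    (hη : ∃ n : ℕ, Nivat.complexity η (Nivat.rect n 3) ≤ 3 * n)
    (d : ℝ × ℝ) (hd : d ≠ 0) (hℓ : Nivat.IsNonexpansiveDirection η d)
    (c : ℝ) (f g : ℤ × ℤ → A)
    (hf : f ∈ Nivat.orbitClosure η) (hg : g ∈ Nivat.orbitClosure η) (hfg : f ≠ g)
    (hH : Nivat.AgreeOn f g (Nivat.halfPlane d c)) :
    (Nivat.IsPeriodicAlong d f ∧ Nivat.IsPeriodicAlong d g) ∧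
    ∀ (S : Set (ℤ × ℤ)) (a b : ℤ × ℤ),
      Nivat.IsBalanced η d S → Nivat.MeetsEveryLine d S →
      Nivat.IsEdge S a b → Nivat.PointsAlong d (b - a) →
      ∀ u : ℤ × ℤ,
        (¬ Nivat.ExtendsUniquely η (Nivat.shift u f)
            (Nivat.border d (S \ Nivat.edgePoints a b)) (Nivat.border d S) →
          Nivat.HasPeriodAtMost d (Nivat.border d (S \ Nivat.edgePoints a b)) (Nivat.shift u f)
            ((Nivat.edgePoints a b).ncard - 1)) ∧
        (Nivat.ExtendsUniquely η (Nivat.shift u f)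
            (Nivat.border d (S \ Nivat.edgePoints a b)) (Nivat.border d S) →
          Nivat.HasPeriodAtMost d (Nivat.border d (S \ Nivat.edgePoints a b)) (Nivat.shift u f)
            (2 * (Nivat.edgePoints a b).ncard - 2)) := by
  open Nivat in
  obtain ⟨n, hn⟩ := hη
  obtain ⟨v, hv, κ, hκ, rfl⟩ := exists_primitive_direction (rect_finite n 3)
    (by rw [ncard_rect]; omega) hd hf hg hfg hH
  obtain ⟨e, he⟩ := exists_lev_eq_one hv
  -- the highest level on which `f` and `g` differ
  obtain ⟨i₀, ⟨z₀, rfl, hz₀⟩, hmax⟩ := Int.exists_greatest_of_bdd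
    (P := fun i => ∃ z, lev v z = i ∧ f z ≠ g z)
    ⟨⌈c / κ⌉, by
      rintro _ ⟨z, rfl, hz⟩
      by_contra! h
      refine hz (hH z ?_)
      have h1 := (Int.le_ceil (c / κ)).trans (Int.cast_lt.2 h).le
      rw [div_le_iff₀ hκ] at h1
      simp only [halfPlane, Set.mem_ofPred_eq, cross_smul_toPlane]
      linarith⟩
    (by
      obtain ⟨z, hz⟩ := Function.ne_iff.1 hfg
      exact ⟨_, z, rfl, hz⟩)
  have hag : ∀ z, lev v z₀ < lev v z → f z = g z := fun z hz => by
    by_contra h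
    have := hmax _ ⟨z, rfl, h⟩
    omega
  obtain ⟨M, hM, hper⟩ := exists_period_of_agree hn hv hf hg hz₀ hag
  obtain ⟨M', hM', hper'⟩ := exists_period_of_agree hn hv hg hf (Ne.symm hz₀)
    fun z hz => (hag z hz).symm
  have hne : ∀ M : ℕ, 1 ≤ M → (M : ℤ) • v ≠ 0 ∧ cross (κ • toPlane v) (toPlane ((M : ℤ) • v)) = 0 :=
    fun M hM => ⟨smul_ne_zero (by omega) (ne_zero_of_isCoprime hv), by
      rw [cross_smul_toPlane, lev_smul, lev_self]; simp⟩
  refine ⟨⟨⟨_, (hne M hM).1, (hne M hM).2, hper⟩, ⟨_, (hne M' hM').1, (hne M' hM').2, hper'⟩⟩,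
    fun S a b hS hmeet hab hpt u => ?_⟩
  obtain ⟨m, hi, hcard, hstrip, hB, hB'⟩ := hS.exists_isStripSet hv hκ hmeet hab hpt
  have hfu := shift_mem_orbitClosure hf u
  have hgoal : ∀ N : ℕ, (∃ p : ℕ, 1 ≤ p ∧ p ≤ N ∧ ∀ z, lev v a < lev v z → lev v z ≤ hi →
      shift u f (z + (p : ℤ) • v) = shift u f z) →
      HasPeriodAtMost (κ • toPlane v) (border (κ • toPlane v) (S \ edgePoints a b)) (shift u f) N := by
    rintro N ⟨p, h1, h2, h3⟩
    refine ⟨v, ⟨κ⁻¹, inv_pos.2 hκ, ?_⟩, Int.isCoprime_iff_gcd_eq_one.1 hv, p, h1, h2, fun z hz => ?_⟩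
    · rw [smul_smul, inv_mul_cancel₀ hκ.ne', one_smul]
    · obtain ⟨h4, h5⟩ := (hB' z).1 hz
      rw [← natCast_zsmul]
      exact h3 z h4 h5
  refine ⟨fun hnu => hgoal _ ?_, fun _ => hgoal _ ?_⟩
  · rw [hcard, Nat.add_sub_cancel]
    refine (hstrip.period_of_not_unique hv hfu fun hu => hnu fun β hβ heq z hz => ?_).1
    obtain ⟨h1, h2⟩ := (hB z).1 hz
    rcases eq_or_lt_of_le h1 with h | h
    · exact hu β hβ (fun z h1 h2 => heq ((hB' z).2 ⟨h1, h2⟩)) z h.symm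
    · exact heq ((hB' z).2 ⟨h, h2⟩)
  · rw [hcard, show 2 * (m + 1) - 2 = 2 * m by omega]
    refine hstrip.period_le hv hfu he hM (fun z => ?_)
      (t₁ := lev v z₀ - lev v u - lev v a) fun hu => hz₀ ?_
    · simp only [shift]
      rw [add_right_comm, hper]
    · set t := lev v z₀ - lev v u - lev v a with ht
      have := hu (shift (t • e) (shift u g)) (shift_mem_orbitClosure (shift_mem_orbitClosure hg _) _)
        (fun z h1 _ => hag _ (by simp only [lev_add, lev_smul, he]; omega))
        (z₀ - t • e - u) (by simp only [lev_sub, lev_smul, he]; omega)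
      simp only [shift] at this
      rwa [show z₀ - t • e - u + t • e + u = z₀ by abel] at this
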